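/- Let $\mathcal E$ be a category with finite limits and terminal object $1$. *Polynomials.* A polynomial $p$ in $\mathcal E$ is a morphism $p_*\to P$ (from directions to positions) which is exponentiable, i.e. the pullback functor $\mathcal E/P\to\mathcal E/p_*$ has a right adjoint $\Pi_p$. Its polynomial functor is the composite $\mathbf P(p):\mathcal E\xrightarrow{-\times p_*}\mathcal E/p_*\xrightarrow{\Pi_p}\mathcal E/P\to\mathcal E$, the last functor forgetting the map to $P$. A morphism $\varphi:p\to q$ consists of $\varphi_1:P\to Q$ and a morphism $P\times_Q q_*\to p_*$ over $P$; it induces a natural transformation $\mathbf P(\varphi):\mathbf P(p)\to\mathbf P(q)$ by applying $\varphi_1$ to positions and precomposing with the map on directions. These form a category $\mathbf{Poly}_{\mathcal E}$. It is monoidal under the composition product $\triangleleft$ with unit $y=(1\to1)$: $p\triangleleft q$ has object of positions $\mathbf P(p)(Q)$ and object of directions $(\mathbf P(p)(Q)\times_P p_*)\times_Q q_*$, formed with the evaluation map $\mathbf P(p)(Q)\times_P p_*\to Q$, and there are canonical natural isomorphisms $\mathbf P(p\triangleleft q)\cong\mathbf P(p)\circ\mathbf P(q)$ and $\mathbf P(y)\cong\mathrm{id}_{\mathcal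 E}$. *Comonoids, coalgebras, bicomodules.* A comonoid in $\mathbf{Poly}_{\mathcal E}$ is a comonoid in $(\mathbf{Poly}_{\mathcal E},y,\triangleleft)$; via the isomorphisms above a comonoid $c$ makes $\mathbf P(c)$ a comonad on $\mathcal E$. The category $c\text{-}\mathbf{coalg}$ has as objects the coalgebras of this comonad, that is, objects $S$ of $\mathcal E$ with a counital and coassociative morphism $S\to\mathbf P(c)(S)$, and as morphisms the morphisms of $\mathcal E$ commuting with the structure maps. For comonoids $c,d$, a $(c,d)$-bicomodule is a polynomial $m$ with a counital, coassociative left coaction $\kappa:m\to c\triangleleft m$ and a counital, coassociative right coaction $\chi:m\to m\triangleleft d$ such that, up to the associator, $(\mathrm{id}_c\triangleleft\chi)\circ\kappa=(\kappa\triangleleft\mathrm{id}_d)\circ\chi$. **Theorem.** Let $c,d$ be comonoids in $\mathbf{Poly}_{\mathcal E}$ and let $(m,\kappa,\chi)$ be a $(c,d)$-bicomodule. Then there are a functor $F:d\text{-}\mathbf{coalg}\to c\text{-}\mathbf{coalg}$ and morphisms $\iota_S:F(S)\to\mathbf P(m)(S)$ in $\mathcal E$, natural in the $d$-coalgebra $(S,\kappa':S\to\mathbf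 P(d)(S))$, such that: 1. for every $d$-coalgebra $(S,\kappa')$, $\iota_S$ is an equalizer in $\mathcal E$ of the two morphisms $\mathbf P(m)(S)\rightrightarrows\mathbf P(m)(\mathbf P(d)(S))$ given by $\mathbf P(m)(S)\xrightarrow{\mathbf P(\chi)_S}\mathbf P(m\triangleleft d)(S)\cong\mathbf P(m)(\mathbf P(d)(S))$ and by $\mathbf P(m)(\kappa')$; 2. the coalgebra structure on $F(S)$ is induced by $\kappa$: the composite $F(S)\to\mathbf P(c)(F(S))\xrightarrow{\mathbf P(c)(\iota_S)}\mathbf P(c)(\mathbf P(m)(S))$ of the structure map of $F(S)$ with $\mathbf P(c)(\iota_S)$ equals the composite $F(S)\xrightarrow{\iota_S}\mathbf P(m)(S)\xrightarrow{\mathbf P(\kappa)_S}\mathbf P(c\triangleleft m)(S)\cong\mathbf P(c)(\mathbf P(m)(S))$; 3. $F$ preserves connected limits: for every (nonempty) connected category $J$, $F$ preserves all limits of shape $J$ that exist in $d\text{-}\mathbf{coalg}$. -/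

import Mathlib

open CategoryTheory CategoryTheory.Limits

universe w' w v u

noncomputable section

namespace CategoryTheory

attribute [local simp] pullback.lift_fst pullback.lift_fst_assoc pullback.lift_snd
  pullback.lift_snd_assoc

variable {E : Type u} [Category.{v} E]

/-- The pullback of an exponentiable morphism is exponentiable. -/
theorem isLeftAdjoint_pullback_fst [HasPullbacks E] {A A' B : E} (g : A' ⟶ A) (f : B ⟶ A)
    [(Over.pullback f).IsLeftAdjoint] :
    (Over.pullback (pullback.fst g f)).IsLeftAdjoint := by
  let G : Over A' ⥤ Over (pullback g f) :=
    (Over.mk g).iteratedSliceBackward ⋙ Over.post (X := Over.mk g) (Over.pullback f) ⋙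
      ((Over.pullback f).obj (Over.mk g)).iteratedSliceForward
  have : (Over.mk g).iteratedSliceBackward.IsLeftAdjoint :=
    inferInstanceAs ((Over.mk g).iteratedSliceEquiv.inverse.IsLeftAdjoint)
  have : ((Over.pullback f).obj (Over.mk g)).iteratedSliceForward.IsLeftAdjoint :=
    inferInstanceAs (((Over.pullback f).obj (Over.mk g)).iteratedSliceEquiv.functor.IsLeftAdjoint)
  have : G.IsLeftAdjoint := by infer_instance
  have h₁ {D : E} (h : D ⟶ A') : (pullbackRightPullbackFstIso g f h).inv ≫
      pullback.snd h (pullback.fst g f) =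
      pullback.lift (pullback.fst (h ≫ g) f ≫ h) (pullback.snd (h ≫ g) f)
        (by simp [pullback.condition]) := by
    rw [Iso.inv_comp_eq]
    apply pullback.hom_ext <;> simp [pullback.condition]
  have h₂ {X Y : E} (k : X ⟶ Y) (x : X ⟶ A') (y : Y ⟶ A') (w : k ≫ y = x) :
      pullback.lift (f := y ≫ g) (g := f) (pullback.fst (x ≫ g) f ≫ k) (pullback.snd (x ≫ g) f)
        (by simp [← pullback.condition, reassoc_of% w]) ≫
          (pullbackRightPullbackFstIso g f y).inv =
      (pullbackRightPullbackFstIso g f x).inv ≫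
        pullback.lift (pullback.fst x (pullback.fst g f) ≫ k) (pullback.snd x (pullback.fst g f))
          (by simp [← pullback.condition, w]) := by
    rw [Iso.eq_inv_comp, ← Category.assoc, Iso.comp_inv_eq]
    apply pullback.hom_ext <;> simp
  exact Functor.isLeftAdjoint_of_iso (F := G) (NatIso.ofComponents (fun D => Over.isoMk
    (pullbackRightPullbackFstIso g f D.hom).symm (h₁ D.hom))
      (fun {X Y} k => Over.OverMorphism.ext (h₂ k.left X.hom Y.hom (Over.w k))))

theorem isLeftAdjoint_pullback_comp [HasPullbacks E] {A B C : E} (f : A ⟶ B) (g : B ⟶ C)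
    [(Over.pullback f).IsLeftAdjoint] [(Over.pullback g).IsLeftAdjoint] :
    (Over.pullback (f ≫ g)).IsLeftAdjoint :=
  Functor.isLeftAdjoint_of_iso (Over.pullbackComp f g).symm

theorem isLeftAdjoint_pullback_id [HasPullbacks E] (A : E) :
    (Over.pullback (𝟙 A)).IsLeftAdjoint :=
  Functor.isLeftAdjoint_of_iso (Over.pullbackId (X := A)).symm

/-- A polynomial in `E`: an exponentiable morphism `proj : dir ⟶ pos`, that is, a morphism such
that the pullback functor `Over pos ⥤ Over dir` has a right adjoint. -/
structure PolyIn (E : Type u) [Category.{v} E] [HasPullbacks E] where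
  /-- the object of positions (the base) -/
  pos : E
  /-- the object of directions (the total space) -/
  dir : E
  /-- the underlying morphism -/
  proj : dir ⟶ pos
  exponentiable : (Over.pullback proj).IsLeftAdjoint

namespace PolyIn

attribute [instance] PolyIn.exponentiable

section Category

variable [HasPullbacks E]

/-- A morphism of polynomials: a map on positions, and a map
`p.pos ×_{q.pos} q.dir ⟶ p.dir` over `p.pos`.  (With the chosen pullbacks, each isomorphism class
of representing diagrams has exactly one representative of this form.) -/
@[ext]
structure Hom (p q : PolyIn E) where
  onPos : p.pos ⟶ q.pos
  onDir : pullback onPos q.proj ⟶ p.dir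
  onDir_proj : onDir ≫ p.proj = pullback.fst onPos q.proj

attribute [simp] Hom.onDir_proj

/-- The action of a morphism of polynomials on generalized elements: it sends a position `b` of `p`
and a direction `y` of `q` at the image of `b` to a direction of `p` at `b`. -/
def Hom.dirAt {p q : PolyIn E} (φ : Hom p q) {B : E} (b : B ⟶ p.pos) (y : B ⟶ q.dir)
    (w : b ≫ φ.onPos = y ≫ q.proj) : B ⟶ p.dir :=
  pullback.lift b y w ≫ φ.onDir

@[simp]
theorem Hom.dirAt_proj {p q : PolyIn E} (φ : Hom p q) {B : E} (b : B ⟶ p.pos) (y : B ⟶ q.dir)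
    (w : b ≫ φ.onPos = y ≫ q.proj) : φ.dirAt b y w ≫ p.proj = b := by
  simp [dirAt]

@[simp]
theorem Hom.comp_dirAt {p q : PolyIn E} (φ : Hom p q) {B C : E} (u : C ⟶ B) (b : B ⟶ p.pos)
    (y : B ⟶ q.dir) (w : b ≫ φ.onPos = y ≫ q.proj) :
    u ≫ φ.dirAt b y w = φ.dirAt (u ≫ b) (u ≫ y) (by simp [w]) := by
  rw [dirAt, dirAt, ← Category.assoc]
  congr 1
  apply pullback.hom_ext <;> simp

theorem Hom.comp_dirAt_eq {p q : PolyIn E} (φ : Hom p q) {B C : E} (u : C ⟶ B) (b : B ⟶ p.pos)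
    (y : B ⟶ q.dir) (w : b ≫ φ.onPos = y ≫ q.proj) {b' : C ⟶ p.pos} {y' : C ⟶ q.dir}
    (hb : u ≫ b = b') (hy : u ≫ y = y') :
    u ≫ φ.dirAt b y w = φ.dirAt b' y' (by simp [← hb, ← hy, w]) := by
  subst hb hy
  exact φ.comp_dirAt u b y w

theorem Hom.dirAt_congr {p q : PolyIn E} (φ : Hom p q) {B : E} {b b' : B ⟶ p.pos}
    {y y' : B ⟶ q.dir} (hb : b = b') (hy : y = y') (w : b ≫ φ.onPos = y ≫ q.proj) :
    φ.dirAt b y w = φ.dirAt b' y' (by rw [← hb, ← hy, w]) := by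
  subst hb hy
  rfl

theorem Hom.ext_dirAt {p q : PolyIn E} {φ ψ : Hom p q} (h : φ.onPos = ψ.onPos)
    (h' : ∀ {B : E} (b : B ⟶ p.pos) (y : B ⟶ q.dir) (w : b ≫ φ.onPos = y ≫ q.proj)
      (w' : b ≫ ψ.onPos = y ≫ q.proj), φ.dirAt b y w = ψ.dirAt b y w') : φ = ψ := by
  obtain ⟨f, g, hg⟩ := φ
  obtain ⟨f', g', hg'⟩ := ψ
  obtain rfl : f = f' := h
  have := h' (pullback.fst f q.proj) (pullback.snd f q.proj) pullback.condition pullback.condition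
  simpa [dirAt] using this

/-- The identity morphism. -/
def Hom.id (p : PolyIn E) : Hom p p where
  onPos := 𝟙 p.pos
  onDir := pullback.snd (𝟙 p.pos) p.proj
  onDir_proj := by simp [← pullback.condition]

/-- Composition of morphisms of polynomials: on directions, first `ψ`, then `φ`. -/
def Hom.comp {p q r : PolyIn E} (φ : Hom p q) (ψ : Hom q r) : Hom p r where
  onPos := φ.onPos ≫ ψ.onPos
  onDir := φ.dirAt (pullback.fst (φ.onPos ≫ ψ.onPos) r.proj)
    (ψ.dirAt (pullback.fst (φ.onPos ≫ ψ.onPos) r.proj ≫ φ.onPos)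
      (pullback.snd (φ.onPos ≫ ψ.onPos) r.proj) (by simp [pullback.condition])) (by simp)
  onDir_proj := by simp

theorem Hom.dirAt_id (p : PolyIn E) {B : E} (b : B ⟶ p.pos) (y : B ⟶ p.dir)
    (w : b ≫ (Hom.id p).onPos = y ≫ p.proj) : (Hom.id p).dirAt b y w = y :=
  pullback.lift_snd _ _ _

theorem Hom.dirAt_comp {p q r : PolyIn E} (φ : Hom p q) (ψ : Hom q r) {B : E} (b : B ⟶ p.pos)
    (y : B ⟶ r.dir) (w : b ≫ (φ.comp ψ).onPos = y ≫ r.proj) :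
    (φ.comp ψ).dirAt b y w = φ.dirAt b (ψ.dirAt (b ≫ φ.onPos) y
      ((Category.assoc _ _ _).trans w)) (by simp) :=
  φ.comp_dirAt_eq _ _ _ _ (pullback.lift_fst _ _ _)
    (ψ.comp_dirAt_eq _ _ _ _ (pullback.lift_fst_assoc _ _ _ _) (pullback.lift_snd _ _ _))

instance : Category (PolyIn E) where
  Hom := Hom
  id := Hom.id
  comp := Hom.comp
  id_comp φ := Hom.ext_dirAt (Category.id_comp _) (fun b y w w' => by
    rw [Hom.dirAt_comp, Hom.dirAt_id]
    exact φ.dirAt_congr (Category.comp_id _) rfl _)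
  comp_id φ := Hom.ext_dirAt (Category.comp_id _) (fun b y w w' => by
    rw [Hom.dirAt_comp]
    exact φ.dirAt_congr rfl (Hom.dirAt_id _ _ _ _) _)
  assoc φ ψ χ := Hom.ext_dirAt (Category.assoc _ _ _) (fun b y w w' => by
    simp only [Hom.dirAt_comp]
    exact φ.dirAt_congr rfl
      (ψ.dirAt_congr rfl (χ.dirAt_congr (Category.assoc _ _ _).symm rfl _) _) _)

@[simp]
theorem id_onPos (p : PolyIn E) : Hom.onPos (𝟙 p) = 𝟙 p.pos := rfl

@[simp]
theorem comp_onPos {p q r : PolyIn E} (φ : p ⟶ q) (ψ : q ⟶ r) :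
    Hom.onPos (φ ≫ ψ) = φ.onPos ≫ ψ.onPos := rfl

@[simp]
theorem id_dirAt (p : PolyIn E) {B : E} (b : B ⟶ p.pos) (y : B ⟶ p.dir)
    (w : b ≫ Hom.onPos (𝟙 p) = y ≫ p.proj) : Hom.dirAt (𝟙 p) b y w = y :=
  Hom.dirAt_id p b y w

@[simp]
theorem comp_dirAt {p q r : PolyIn E} (φ : p ⟶ q) (ψ : q ⟶ r) {B : E} (b : B ⟶ p.pos)
    (y : B ⟶ r.dir) (w : b ≫ Hom.onPos (φ ≫ ψ) = y ≫ r.proj) :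
    Hom.dirAt (φ ≫ ψ) b y w = φ.dirAt b (ψ.dirAt (b ≫ φ.onPos) y
      ((Category.assoc _ _ _).trans w)) (by simp) :=
  Hom.dirAt_comp φ ψ b y w

end Category

variable [HasFiniteLimits E]

/-! ### Polynomial functors -/

/-- The polynomial functor `E ≌ Over 1 ⥤ Over p.dir ⥤ Over p.pos ⥤ Over 1 ≌ E` of `p`: take the
product with `p.dir`, apply the right adjoint of pulling back along `p.proj`, and forget the map
to `p.pos`. -/
def eval (p : PolyIn E) : E ⥤ E :=
  Over.star p.dir ⋙ (Over.pullback p.proj).rightAdjoint ⋙ Over.forget p.pos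

/-- The adjunction which yields the universal property of the polynomial functor. -/
def evalAdj (p : PolyIn E) : Over.pullback p.proj ⋙ Over.forget p.dir ⊣
    Over.star p.dir ⋙ (Over.pullback p.proj).rightAdjoint :=
  (Adjunction.ofIsLeftAdjoint (Over.pullback p.proj)).comp (Over.forgetAdjStar p.dir)

/-- The projection of `p.eval.obj A` to the positions. -/
def evalFst (p : PolyIn E) (A : E) : p.eval.obj A ⟶ p.pos :=
  ((Over.star p.dir ⋙ (Over.pullback p.proj).rightAdjoint).obj A).hom

/-- The universal evaluation map `p.eval.obj A ×_{p.pos} p.dir ⟶ A`. -/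
def ev (p : PolyIn E) (A : E) : pullback (p.evalFst A) p.proj ⟶ A :=
  p.evalAdj.counit.app A

/-- The universal property of `p.eval.obj A`: a map to it is given by a map `f` to `p.pos` together
with a map `B ×_{p.pos} p.dir ⟶ A`. -/
def evalMk (p : PolyIn E) {A B : E} (f : B ⟶ p.pos) (g : pullback f p.proj ⟶ A) :
    B ⟶ p.eval.obj A :=
  (p.evalAdj.homEquiv (Over.mk f) A g).left

/-- Evaluation of a generalized element of `p.eval.obj A` at a generalized direction. -/
def evalAt (p : PolyIn E) {A B : E} (z : B ⟶ p.eval.obj A) (x : B ⟶ p.dir)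
    (w : z ≫ p.evalFst A = x ≫ p.proj) : B ⟶ A :=
  pullback.lift z x w ≫ p.ev A

@[simp]
theorem evalMk_fst (p : PolyIn E) {A B : E} (f : B ⟶ p.pos) (g : pullback f p.proj ⟶ A) :
    p.evalMk f g ≫ p.evalFst A = f :=
  Over.w (p.evalAdj.homEquiv (Over.mk f) A g)

@[simp]
theorem evalMk_fst_assoc (p : PolyIn E) {A B Z : E} (f : B ⟶ p.pos)
    (g : pullback f p.proj ⟶ A) (k : p.pos ⟶ Z) :
    p.evalMk f g ≫ p.evalFst A ≫ k = f ≫ k := by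
  rw [← Category.assoc, evalMk_fst]

@[simp]
theorem eval_map_fst (p : PolyIn E) {A B : E} (h : A ⟶ B) :
    p.eval.map h ≫ p.evalFst B = p.evalFst A :=
  Over.w ((Over.star p.dir ⋙ (Over.pullback p.proj).rightAdjoint).map h)

@[simp]
theorem eval_map_fst_assoc (p : PolyIn E) {A B Z : E} (h : A ⟶ B) (k : p.pos ⟶ Z) :
    p.eval.map h ≫ p.evalFst B ≫ k = p.evalFst A ≫ k := by
  rw [← Category.assoc, eval_map_fst]

@[simp]
theorem comp_evalAt (p : PolyIn E) {A B C : E} (u : C ⟶ B) (z : B ⟶ p.eval.obj A) (x : B ⟶ p.dir)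
    (w : z ≫ p.evalFst A = x ≫ p.proj) :
    u ≫ p.evalAt z x w = p.evalAt (u ≫ z) (u ≫ x) (by simp [w]) := by
  rw [evalAt, evalAt, ← Category.assoc]
  congr 1
  apply pullback.hom_ext <;> simp

theorem evalAt_comp_eval_map (p : PolyIn E) {A A' B : E} (z : B ⟶ p.eval.obj A) (x : B ⟶ p.dir)
    (h : A ⟶ A') (w : (z ≫ p.eval.map h) ≫ p.evalFst A' = x ≫ p.proj) :
    p.evalAt (z ≫ p.eval.map h) x w = p.evalAt z x (by simpa using w) ≫ h := by
  have := p.evalAdj.counit.naturality h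
  have e : pullback.lift (pullback.fst (p.evalFst A) p.proj ≫ p.eval.map h)
      (pullback.snd (p.evalFst A) p.proj) (by simp [pullback.condition]) ≫ p.ev A' =
      p.ev A ≫ h := this
  rw [evalAt, evalAt, Category.assoc, ← e, ← Category.assoc]
  congr 1
  apply pullback.hom_ext <;> simp

theorem evalAt_evalMk (p : PolyIn E) {A B C : E} (f : B ⟶ p.pos) (g : pullback f p.proj ⟶ A)
    (b : C ⟶ B) (x : C ⟶ p.dir) (w : (b ≫ p.evalMk f g) ≫ p.evalFst A = x ≫ p.proj) :
    p.evalAt (b ≫ p.evalMk f g) x w = pullback.lift b x (by simpa using w) ≫ g := by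
  have : pullback.lift (pullback.fst f p.proj ≫ p.evalMk f g) (pullback.snd f p.proj)
      (by simp [pullback.condition]) ≫ p.ev A = g :=
    (p.evalAdj.homEquiv_counit (X := Over.mk f) (Y := A)
      (g := p.evalAdj.homEquiv (Over.mk f) A g)).symm.trans
        ((p.evalAdj.homEquiv (Over.mk f) A).symm_apply_apply g)
  refine Eq.trans ?_ (congrArg (fun k => pullback.lift b x (by simpa using w) ≫ k) this)
  rw [evalAt, ← Category.assoc]
  congr 1
  apply pullback.hom_ext <;> simp

theorem eval_hom_ext (p : PolyIn E) {A B : E} {z z' : B ⟶ p.eval.obj A}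
    (h : z ≫ p.evalFst A = z' ≫ p.evalFst A)
    (h' : ∀ {C : E} (b : C ⟶ B) (x : C ⟶ p.dir) (w : (b ≫ z) ≫ p.evalFst A = x ≫ p.proj)
      (w' : (b ≫ z') ≫ p.evalFst A = x ≫ p.proj),
      p.evalAt (b ≫ z) x w = p.evalAt (b ≫ z') x w') : z = z' := by
  let U : Over.mk (z ≫ p.evalFst A) ⟶
    (Over.star p.dir ⋙ (Over.pullback p.proj).rightAdjoint).obj A := Over.homMk z rfl
  let U' : Over.mk (z ≫ p.evalFst A) ⟶
    (Over.star p.dir ⋙ (Over.pullback p.proj).rightAdjoint).obj A := Over.homMk z' h.symm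
  suffices U = U' from congrArg (fun k => k.left) this
  apply (p.evalAdj.homEquiv _ _).symm.injective
  rw [p.evalAdj.homEquiv_counit, p.evalAdj.homEquiv_counit]
  exact h' (pullback.fst (z ≫ p.evalFst A) p.proj) (pullback.snd (z ≫ p.evalFst A) p.proj)
    (by simp [pullback.condition]) (by simp [← h, pullback.condition])

theorem comp_evalAt_eq (p : PolyIn E) {A B C : E} (u : C ⟶ B) (z : B ⟶ p.eval.obj A)
    (x : B ⟶ p.dir) (w : z ≫ p.evalFst A = x ≫ p.proj) {z' : C ⟶ p.eval.obj A} {x' : C ⟶ p.dir}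
    (hz : u ≫ z = z') (hx : u ≫ x = x') :
    u ≫ p.evalAt z x w = p.evalAt z' x' (by simp [← hz, ← hx, w]) := by
  subst hz hx
  exact p.comp_evalAt u z x w

theorem evalAt_congr (p : PolyIn E) {A B : E} {z z' : B ⟶ p.eval.obj A}
    {x x' : B ⟶ p.dir} (hz : z = z') (hx : x = x') (w : z ≫ p.evalFst A = x ≫ p.proj) :
    p.evalAt z x w = p.evalAt z' x' (by rw [← hz, ← hx, w]) := by
  subst hz hx
  rfl

/-- The natural transformation of polynomial functors induced by a morphism of polynomials, at an
object `A`: it sends an element `z` over the position `b` to the element over `φ b` whose value at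
a direction `y` is the value of `z` at `φ.dirAt b y`. -/
def evalMapApp {p q : PolyIn E} (φ : p ⟶ q) (A : E) : p.eval.obj A ⟶ q.eval.obj A :=
  q.evalMk (p.evalFst A ≫ φ.onPos)
    (p.evalAt (pullback.fst (p.evalFst A ≫ φ.onPos) q.proj)
      (φ.dirAt (pullback.fst (p.evalFst A ≫ φ.onPos) q.proj ≫ p.evalFst A)
        (pullback.snd (p.evalFst A ≫ φ.onPos) q.proj) (by simp [pullback.condition])) (by simp))

@[simp]
theorem evalMapApp_fst {p q : PolyIn E} (φ : p ⟶ q) (A : E) :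
    evalMapApp φ A ≫ q.evalFst A = p.evalFst A ≫ φ.onPos :=
  evalMk_fst _ _ _

@[simp]
theorem evalMapApp_fst_assoc {p q : PolyIn E} (φ : p ⟶ q) (A : E) {Z : E} (k : q.pos ⟶ Z) :
    evalMapApp φ A ≫ q.evalFst A ≫ k = p.evalFst A ≫ φ.onPos ≫ k := by
  rw [← Category.assoc, evalMapApp_fst, Category.assoc]

theorem evalAt_evalMapApp {p q : PolyIn E} (φ : p ⟶ q) {A B : E} (z : B ⟶ p.eval.obj A)
    (y : B ⟶ q.dir) (w : (z ≫ evalMapApp φ A) ≫ q.evalFst A = y ≫ q.proj) :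
    q.evalAt (z ≫ evalMapApp φ A) y w =
      p.evalAt z (φ.dirAt (z ≫ p.evalFst A) y (by simpa using w)) (by simp) := by
  refine (q.evalAt_evalMk _ _ _ _ _).trans ?_
  exact p.comp_evalAt_eq _ _ _ _ (pullback.lift_fst _ _ _) (φ.comp_dirAt_eq _ _ _ _
        (pullback.lift_fst_assoc _ _ _ _) (pullback.lift_snd _ _ _))

/-- The natural transformation of polynomial functors induced by a morphism of polynomials. -/
@[simps app]
def evalMap {p q : PolyIn E} (φ : p ⟶ q) : p.eval ⟶ q.eval where
  app := evalMapApp φ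
  naturality A A' h := by
    refine eval_hom_ext _ (by simp) (fun b x w w' => ?_)
    have e₁ : b ≫ p.eval.map h ≫ evalMapApp φ A' = (b ≫ p.eval.map h) ≫ evalMapApp φ A' :=
      (Category.assoc _ _ _).symm
    have e₂ : b ≫ evalMapApp φ A ≫ q.eval.map h = (b ≫ evalMapApp φ A) ≫ q.eval.map h :=
      (Category.assoc _ _ _).symm
    rw [q.evalAt_congr e₁ rfl, q.evalAt_congr e₂ rfl, evalAt_comp_eval_map, evalAt_evalMapApp,
      evalAt_evalMapApp, evalAt_comp_eval_map]
    congr 1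
    exact p.evalAt_congr rfl (φ.dirAt_congr (by simp) rfl _) _

theorem evalMapApp_naturality {p q : PolyIn E} (φ : p ⟶ q) {A A' : E} (h : A ⟶ A') :
    p.eval.map h ≫ evalMapApp φ A' = evalMapApp φ A ≫ q.eval.map h :=
  (evalMap φ).naturality h

theorem evalMapApp_naturality_assoc {p q : PolyIn E} (φ : p ⟶ q) {A A' : E} (h : A ⟶ A') {Z : E}
    (k : q.eval.obj A' ⟶ Z) :
    p.eval.map h ≫ evalMapApp φ A' ≫ k = evalMapApp φ A ≫ q.eval.map h ≫ k := by
  rw [← Category.assoc, evalMapApp_naturality, Category.assoc]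

theorem evalMap_id (p : PolyIn E) : evalMap (𝟙 p) = 𝟙 p.eval := by
  ext A
  refine eval_hom_ext _ (by simp) (fun b x w w' => ?_)
  refine (evalAt_evalMapApp _ _ _ _).trans ?_
  exact p.evalAt_congr (by simp) (id_dirAt _ _ _ _) _

theorem evalMap_comp {p q r : PolyIn E} (φ : p ⟶ q) (ψ : q ⟶ r) :
    evalMap (φ ≫ ψ) = evalMap φ ≫ evalMap ψ := by
  ext A
  refine eval_hom_ext _ (by simp) (fun b x w w' => ?_)
  have e : b ≫ (evalMap φ ≫ evalMap ψ).app A = (b ≫ evalMapApp φ A) ≫ evalMapApp ψ A :=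
    (Category.assoc _ _ _).symm
  refine (evalAt_evalMapApp _ _ _ _).trans ?_
  rw [r.evalAt_congr e rfl, evalAt_evalMapApp, evalAt_evalMapApp]
  refine p.evalAt_congr rfl ((comp_dirAt _ _ _ _ _).trans
    (φ.dirAt_congr rfl (ψ.dirAt_congr (by simp) rfl _) _)) _

/-- A morphism of polynomials is determined by its natural transformation. -/
theorem evalMap_injective {p q : PolyIn E} {φ ψ : p ⟶ q} (h : evalMap φ = evalMap ψ) : φ = ψ := by
  have hA : evalMapApp φ p.dir = evalMapApp ψ p.dir := congrArg (fun k => k.app p.dir) h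
  have hpos : φ.onPos = ψ.onPos := by
    have := congrArg (fun k => p.evalMk (𝟙 _) (pullback.snd (𝟙 p.pos) p.proj) ≫ k ≫ q.evalFst _) hA
    simpa using this
  refine Hom.ext_dirAt hpos (fun {B} b y w w' => ?_)
  let z : B ⟶ p.eval.obj p.dir := b ≫ p.evalMk (𝟙 _) (pullback.snd (𝟙 p.pos) p.proj)
  have hz : z ≫ p.evalFst _ = b := by simp [z]
  have key (x : B ⟶ p.dir) (hx : z ≫ p.evalFst _ = x ≫ p.proj) : p.evalAt z x hx = x := by
    dsimp only [z]
    rw [evalAt_evalMk]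
    exact pullback.lift_snd _ _ _
  have h₁ := q.evalAt_congr (congrArg (fun k => z ≫ k) hA) (rfl : y = y)
    (by simpa [reassoc_of% hz] using w)
  rw [evalAt_evalMapApp, evalAt_evalMapApp, key, key] at h₁
  exact (φ.dirAt_congr hz.symm rfl _).trans (h₁.trans (ψ.dirAt_congr hz rfl _))

/-! ### The composition product -/

variable (E) in
/-- The identity polynomial: the identity of the terminal object. -/
@[reducible]
def unit : PolyIn E where
  pos := ⊤_ E
  dir := ⊤_ E
  proj := 𝟙 (⊤_ E)
  exponentiable := isLeftAdjoint_pullback_id _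

section

/-- The directions of the composition product. -/
abbrev triDir (p q : PolyIn E) : E := pullback (p.ev q.pos) q.proj

/-- The projection of the composition product. -/
def triProj (p q : PolyIn E) : triDir p q ⟶ p.eval.obj q.pos :=
  pullback.fst (p.ev q.pos) q.proj ≫ pullback.fst (p.evalFst q.pos) p.proj

/-- The composition product of two polynomials. Its positions are `p.eval.obj q.pos`, its
directions `(p.eval.obj q.pos ×_{p.pos} p.dir) ×_{q.pos} q.dir`. -/
@[reducible]
def tri (p q : PolyIn E) : PolyIn E where
  pos := p.eval.obj q.pos
  dir := triDir p q
  proj := triProj p q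
  exponentiable := by
    have h₁ := isLeftAdjoint_pullback_fst (p.ev q.pos) q.proj
    have h₂ := isLeftAdjoint_pullback_fst (p.evalFst q.pos) p.proj
    exact isLeftAdjoint_pullback_comp _ _

variable {p q : PolyIn E}

/-- The `p`-direction underlying a direction of `p.tri q`. -/
def triFst (p q : PolyIn E) : triDir p q ⟶ p.dir :=
  pullback.fst (p.ev q.pos) q.proj ≫ pullback.snd (p.evalFst q.pos) p.proj

/-- The `q`-direction underlying a direction of `p.tri q`. -/
def triSnd (p q : PolyIn E) : triDir p q ⟶ q.dir :=
  pullback.snd (p.ev q.pos) q.proj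

theorem triProj_fst (p q : PolyIn E) :
    triProj p q ≫ p.evalFst q.pos = p.triFst q ≫ p.proj := by
  simp only [triFst, triProj, triDir, pullback.condition, Category.assoc]

theorem triSnd_proj (p q : PolyIn E) :
    p.evalAt (triProj p q) (p.triFst q) (p.triProj_fst q) = p.triSnd q ≫ q.proj := by
  refine Eq.trans ?_ pullback.condition
  rw [evalAt]
  congr 1
  apply pullback.hom_ext <;> simp [triFst, triProj]

/-- A generalized direction of `p.tri q` at `z` is a direction `x` of `p` together with a direction
`y` of `q` at the value of `z` at `x`. -/
def triMk {B : E} (z : B ⟶ p.eval.obj q.pos) (x : B ⟶ p.dir) (y : B ⟶ q.dir)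
    (wx : z ≫ p.evalFst q.pos = x ≫ p.proj) (wy : p.evalAt z x wx = y ≫ q.proj) :
    B ⟶ triDir p q :=
  pullback.lift (pullback.lift z x wx) y wy

section

variable {B : E} (z : B ⟶ p.eval.obj q.pos) (x : B ⟶ p.dir) (y : B ⟶ q.dir)
    (wx : z ≫ p.evalFst q.pos = x ≫ p.proj) (wy : p.evalAt z x wx = y ≫ q.proj)

@[simp]
theorem triMk_proj : triMk z x y wx wy ≫ triProj p q = z :=
  (pullback.lift_fst_assoc _ _ _ _).trans (pullback.lift_fst _ _ _)

@[simp]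
theorem triMk_fst : triMk z x y wx wy ≫ p.triFst q = x :=
  (pullback.lift_fst_assoc _ _ _ _).trans (pullback.lift_snd _ _ _)

@[simp]
theorem triMk_snd : triMk z x y wx wy ≫ p.triSnd q = y :=
  pullback.lift_snd _ _ _

theorem tri_hom_ext {t t' : B ⟶ triDir p q} (h : t ≫ triProj p q = t' ≫ triProj p q)
    (h₁ : t ≫ p.triFst q = t' ≫ p.triFst q) (h₂ : t ≫ p.triSnd q = t' ≫ p.triSnd q) : t = t' := by
  apply pullback.hom_ext
  · apply pullback.hom_ext
    · exact (Category.assoc _ _ _).trans (h.trans (Category.assoc _ _ _).symm)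
    · exact (Category.assoc _ _ _).trans (h₁.trans (Category.assoc _ _ _).symm)
  · exact h₂

theorem triFst_at (t : B ⟶ triDir p q) (w : z = t ≫ triProj p q) :
    z ≫ p.evalFst q.pos = (t ≫ p.triFst q) ≫ p.proj := by
  rw [w, Category.assoc, triProj_fst, Category.assoc]

theorem triSnd_at (t : B ⟶ triDir p q) (w : z = t ≫ triProj p q) :
    p.evalAt z (t ≫ p.triFst q) (triFst_at z t w) = (t ≫ p.triSnd q) ≫ q.proj := by
  subst w
  rw [Category.assoc, ← triSnd_proj, comp_evalAt]

end

theorem triMk_congr {B : E} {z z' : B ⟶ p.eval.obj q.pos} {x x' : B ⟶ p.dir} {y y' : B ⟶ q.dir}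
    (hz : z = z') (hx : x = x') (hy : y = y')
    (wx : z ≫ p.evalFst q.pos = x ≫ p.proj) (wy : p.evalAt z x wx = y ≫ q.proj) :
    triMk z x y wx wy = triMk z' x' y' (by rw [← hz, ← hx, wx])
      (by subst hz hx hy; exact wy) := by
  subst hz hx hy
  rfl

theorem comp_triMk_eq {B C : E} (u : C ⟶ B) {z : B ⟶ p.eval.obj q.pos} {x : B ⟶ p.dir}
    {y : B ⟶ q.dir} (wx : z ≫ p.evalFst q.pos = x ≫ p.proj) (wy : p.evalAt z x wx = y ≫ q.proj)
    {z' : C ⟶ p.eval.obj q.pos} {x' : C ⟶ p.dir} {y' : C ⟶ q.dir}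
    (hz : u ≫ z = z') (hx : u ≫ x = x') (hy : u ≫ y = y') :
    u ≫ triMk z x y wx wy = triMk z' x' y' (by simp [← hz, ← hx, wx])
      (by subst hz hx hy; rw [← comp_evalAt _ _ _ _ wx, wy, Category.assoc]) := by
  subst hz hx hy
  exact tri_hom_ext (by simp) (by simp) (by simp)

end

/-! ### Compatibility of polynomial functors with the unit and with composition -/

/-- The polynomial functor of the identity polynomial is the identity functor. -/
def evalUnit : (unit E).eval ≅ 𝟭 E :=
  NatIso.ofComponents
    (fun A =>
      { hom := (unit E).evalAt (𝟙 _) (terminal.from _) (Subsingleton.elim _ _)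
        inv := (unit E).evalMk (terminal.from A) (pullback.fst (terminal.from A) (unit E).proj)
        hom_inv_id := eval_hom_ext _ (Subsingleton.elim _ _) (fun b x w w' => by
          have e : b ≫ (unit E).evalAt (𝟙 _) (terminal.from _) (Subsingleton.elim _ _) ≫
              (unit E).evalMk (terminal.from A) (pullback.fst (terminal.from A) (unit E).proj) =
              (b ≫ (unit E).evalAt (𝟙 _) (terminal.from _) (Subsingleton.elim _ _)) ≫
              (unit E).evalMk (terminal.from A) (pullback.fst (terminal.from A) (unit E).proj) :=
            (Category.assoc _ _ _).symm
          rw [evalAt_congr _ e rfl, evalAt_evalMk]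
          refine (pullback.lift_fst _ _ _).trans ?_
          exact comp_evalAt_eq _ _ _ _ _ rfl (Subsingleton.elim _ _))
        inv_hom_id := by
          refine (comp_evalAt _ _ _ _ _).trans ((evalAt_congr _ ((Category.comp_id _).trans
            (Category.id_comp _).symm) rfl _).trans ((evalAt_evalMk _ _ _ _ _ _).trans ?_))
          exact pullback.lift_fst _ _ _ })
    (fun {A B} h => by
      refine (comp_evalAt _ _ _ _ _).trans ((evalAt_congr _ ((Category.comp_id _).trans
            (Category.id_comp _).symm) rfl _).trans ((evalAt_comp_eval_map _ _ _ _ _).trans ?_))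
      exact congrArg (fun k => k ≫ h) (evalAt_congr _ rfl (Subsingleton.elim _ _) _))

section

variable (p q : PolyIn E)

theorem evalComp_fst {p q : PolyIn E} {A B : E} (z : B ⟶ p.eval.obj (q.eval.obj A))
    (t : B ⟶ triDir p q) (w : z ≫ p.eval.map (q.evalFst A) = t ≫ triProj p q) :
    z ≫ p.evalFst (q.eval.obj A) = (t ≫ p.triFst q) ≫ p.proj := by
  rw [Category.assoc, ← triProj_fst, ← reassoc_of% w, eval_map_fst]

theorem evalComp_snd {p q : PolyIn E} {A B : E} (z : B ⟶ p.eval.obj (q.eval.obj A))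
    (t : B ⟶ triDir p q) (w : z ≫ p.eval.map (q.evalFst A) = t ≫ triProj p q) :
    p.evalAt z (t ≫ p.triFst q) (evalComp_fst z t w) ≫ q.evalFst A =
      (t ≫ p.triSnd q) ≫ q.proj := by
  rw [← triSnd_at _ t w, evalAt_comp_eval_map]

/-- The comparison map `p.eval.obj (q.eval.obj A) ⟶ (p.tri q).eval.obj A`: the value of `z` at the
direction `(x, y)` is the value at `y` of the value at `x` of `z`. -/
def evalCompHom (A : E) : p.eval.obj (q.eval.obj A) ⟶ (p.tri q).eval.obj A :=
  (p.tri q).evalMk (p.eval.map (q.evalFst A))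
    (q.evalAt
      (p.evalAt (pullback.fst (p.eval.map (q.evalFst A)) (triProj p q))
        (pullback.snd (p.eval.map (q.evalFst A)) (triProj p q) ≫ p.triFst q)
        (evalComp_fst _ _ pullback.condition))
      (pullback.snd (p.eval.map (q.evalFst A)) (triProj p q) ≫ p.triSnd q)
      (evalComp_snd _ _ pullback.condition))

/-- The inverse comparison map, given by currying. -/
def evalCompInv (A : E) : (p.tri q).eval.obj A ⟶ p.eval.obj (q.eval.obj A) :=
  p.evalMk ((p.tri q).evalFst A ≫ p.evalFst q.pos)
    (q.evalMk
      (p.evalAt (pullback.fst ((p.tri q).evalFst A ≫ p.evalFst q.pos) p.proj ≫ (p.tri q).evalFst A)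
        (pullback.snd ((p.tri q).evalFst A ≫ p.evalFst q.pos) p.proj)
        ((Category.assoc _ _ _).trans pullback.condition))
      ((p.tri q).evalAt
        (pullback.fst _ q.proj ≫ pullback.fst ((p.tri q).evalFst A ≫ p.evalFst q.pos) p.proj)
        (triMk
          (pullback.fst _ q.proj ≫ pullback.fst ((p.tri q).evalFst A ≫ p.evalFst q.pos) p.proj ≫
            (p.tri q).evalFst A)
          (pullback.fst _ q.proj ≫ pullback.snd ((p.tri q).evalFst A ≫ p.evalFst q.pos) p.proj)
          (pullback.snd _ q.proj)
          (by simp [pullback.condition])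
          ((comp_evalAt _ _ _ _ _).symm.trans pullback.condition))
        (by simp)))

variable {p q}

@[simp]
theorem evalCompHom_fst (A : E) :
    p.evalCompHom q A ≫ (p.tri q).evalFst A = p.eval.map (q.evalFst A) :=
  evalMk_fst _ _ _

@[simp]
theorem evalCompHom_fst_assoc (A : E) {Z : E} (k : p.eval.obj q.pos ⟶ Z) :
    p.evalCompHom q A ≫ (p.tri q).evalFst A ≫ k = p.eval.map (q.evalFst A) ≫ k := by
  rw [← Category.assoc, evalCompHom_fst]

theorem evalAt_evalCompHom {A B : E} (z : B ⟶ p.eval.obj (q.eval.obj A)) (t : B ⟶ triDir p q)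
    (w : (z ≫ p.evalCompHom q A) ≫ (p.tri q).evalFst A = t ≫ triProj p q)
    (w' : z ≫ p.eval.map (q.evalFst A) = t ≫ triProj p q) :
    (p.tri q).evalAt (z ≫ p.evalCompHom q A) t w =
      q.evalAt (p.evalAt z (t ≫ p.triFst q) (evalComp_fst z t w')) (t ≫ p.triSnd q)
        (evalComp_snd z t w') := by
  refine ((p.tri q).evalAt_evalMk _ _ _ _ _).trans ?_
  exact q.comp_evalAt_eq _ _ _ _ (p.comp_evalAt_eq _ _ _ _ (pullback.lift_fst _ _ _)
    (pullback.lift_snd_assoc _ _ _ _)) (pullback.lift_snd_assoc _ _ _ _)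

@[simp]
theorem evalCompInv_fst (A : E) :
    p.evalCompInv q A ≫ p.evalFst (q.eval.obj A) = (p.tri q).evalFst A ≫ p.evalFst q.pos :=
  evalMk_fst _ _ _

@[simp]
theorem evalCompInv_fst_assoc (A : E) {Z : E} (k : p.pos ⟶ Z) :
    p.evalCompInv q A ≫ p.evalFst (q.eval.obj A) ≫ k =
      (p.tri q).evalFst A ≫ p.evalFst q.pos ≫ k := by
  rw [← Category.assoc, evalCompInv_fst, Category.assoc]

theorem evalAt_evalCompInv_fst {A B : E} (z : B ⟶ (p.tri q).eval.obj A) (x : B ⟶ p.dir)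
    (w : (z ≫ p.evalCompInv q A) ≫ p.evalFst (q.eval.obj A) = x ≫ p.proj) :
    p.evalAt (z ≫ p.evalCompInv q A) x w ≫ q.evalFst A =
      p.evalAt (z ≫ (p.tri q).evalFst A) x (by simpa using w) := by
  refine (congrArg (fun k => k ≫ q.evalFst A) (p.evalAt_evalMk _ _ _ _ _)).trans ?_
  refine (Category.assoc _ _ _).trans ((congrArg (fun k => _ ≫ k) (evalMk_fst _ _ _)).trans ?_)
  exact p.comp_evalAt_eq _ _ _ _ (pullback.lift_fst_assoc _ _ _ _) (pullback.lift_snd _ _ _)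

theorem evalAt_evalAt_evalCompInv {A B : E} (z : B ⟶ (p.tri q).eval.obj A) (x : B ⟶ p.dir)
    (y : B ⟶ q.dir) (w : (z ≫ p.evalCompInv q A) ≫ p.evalFst (q.eval.obj A) = x ≫ p.proj)
    (w' : p.evalAt (z ≫ p.evalCompInv q A) x w ≫ q.evalFst A = y ≫ q.proj) :
    q.evalAt (p.evalAt (z ≫ p.evalCompInv q A) x w) y w' =
      (p.tri q).evalAt z (triMk (z ≫ (p.tri q).evalFst A) x y (by simpa using w)
        ((evalAt_evalCompInv_fst z x w).symm.trans w')) (by simp) := by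
  refine (q.evalAt_congr (p.evalAt_evalMk _ _ _ _ _) rfl _).trans ?_
  refine (q.evalAt_evalMk _ _ _ _ _).trans ?_
  refine comp_evalAt_eq _ _ _ _ _ ?_ (comp_triMk_eq _ _ _ ?_ ?_ ?_)
  · exact (pullback.lift_fst_assoc _ _ _ _).trans (pullback.lift_fst _ _ _)
  · exact (pullback.lift_fst_assoc _ _ _ _).trans (pullback.lift_fst_assoc _ _ _ _)
  · exact (pullback.lift_fst_assoc _ _ _ _).trans (pullback.lift_snd _ _ _)
  · exact pullback.lift_snd _ _ _

@[simp]
theorem evalCompInv_map (A : E) :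
    p.evalCompInv q A ≫ p.eval.map (q.evalFst A) = (p.tri q).evalFst A := by
  refine eval_hom_ext _ (by simp) (fun b x w w' => ?_)
  rw [p.evalAt_congr (Category.assoc _ _ _).symm rfl, evalAt_comp_eval_map, evalAt_evalCompInv_fst]

@[simp]
theorem evalCompHom_inv (A : E) : p.evalCompHom q A ≫ p.evalCompInv q A = 𝟙 _ := by
  refine eval_hom_ext _ (by simp) (fun b x w w' => ?_)
  have e := Category.assoc b (p.evalCompHom q A) (p.evalCompInv q A)
  have e' : b ≫ 𝟙 (p.eval.obj (q.eval.obj A)) = b := Category.comp_id b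
  rw [evalAt_congr _ e.symm rfl, evalAt_congr _ e' rfl]
  refine eval_hom_ext _ ?_ (fun b' y w₁ w₁' => ?_)
  · rw [evalAt_evalCompInv_fst, ← evalAt_comp_eval_map]
    · exact evalAt_congr _ (by simp) rfl _
  · have e₁ : b' ≫ p.evalAt ((b ≫ p.evalCompHom q A) ≫ p.evalCompInv q A) x
        (by rw [e]; exact w) = p.evalAt (((b' ≫ b) ≫ p.evalCompHom q A) ≫
        p.evalCompInv q A) (b' ≫ x) (by simpa using congrArg (fun k => b' ≫ k) w) :=
      comp_evalAt_eq _ _ _ _ _ (by simp) rfl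
    rw [evalAt_congr _ e₁ rfl, evalAt_evalAt_evalCompInv]
    refine (evalAt_evalCompHom _ _ _ (by simp)).trans ?_
    exact evalAt_congr _ ((evalAt_congr _ rfl (by simp) _).trans
        (comp_evalAt _ _ _ _ _).symm) (by simp) _

@[simp]
theorem evalCompHom_inv_assoc (A : E) {Z : E} (k : p.eval.obj (q.eval.obj A) ⟶ Z) :
    p.evalCompHom q A ≫ p.evalCompInv q A ≫ k = k := by
  rw [← Category.assoc, evalCompHom_inv, Category.id_comp]

@[simp]
theorem evalCompInv_hom (A : E) : p.evalCompInv q A ≫ p.evalCompHom q A = 𝟙 _ := by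
  refine eval_hom_ext _ (by simp) (fun b t w w' => ?_)
  have e := Category.assoc b (p.evalCompInv q A) (p.evalCompHom q A)
  have e' : b ≫ 𝟙 ((p.tri q).eval.obj A) = b := Category.comp_id b
  have h : b ≫ (p.tri q).evalFst A = t ≫ triProj p q := by simpa [e'] using w'
  rw [evalAt_congr _ e.symm rfl, evalAt_congr _ e' rfl, evalAt_evalCompHom,
    evalAt_evalAt_evalCompInv]
  · exact evalAt_congr _ rfl (tri_hom_ext (by simp [h]) (by simp) (by simp)) _
  · simpa using h

@[simp]
theorem evalCompInv_hom_assoc (A : E) {Z : E} (k : (p.tri q).eval.obj A ⟶ Z) :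
    p.evalCompInv q A ≫ p.evalCompHom q A ≫ k = k := by
  rw [← Category.assoc, evalCompInv_hom, Category.id_comp]

theorem evalCompHom_naturality {A A' : E} (h : A ⟶ A') :
    p.eval.map (q.eval.map h) ≫ p.evalCompHom q A' =
      p.evalCompHom q A ≫ (p.tri q).eval.map h := by
  refine eval_hom_ext _ (by simp [← Functor.map_comp]) (fun b t w w' => ?_)
  have hw : b ≫ p.eval.map (q.evalFst A) = t ≫ triProj p q := by
    simpa using w'
  have e := Category.assoc b (p.eval.map (q.eval.map h)) (p.evalCompHom q A')
  have e' := Category.assoc b (p.evalCompHom q A) ((p.tri q).eval.map h)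
  refine (evalAt_congr _ e.symm rfl _).trans ?_
  refine Eq.trans ?_ (evalAt_congr _ e' rfl (by rw [e']; exact w'))
  refine (evalAt_evalCompHom (b ≫ p.eval.map (q.eval.map h)) t _ ?_).trans ?_
  · simpa [← Functor.map_comp] using hw
  refine (evalAt_congr _ (evalAt_comp_eval_map _ _ _ _ _) rfl _).trans ?_
  refine (evalAt_comp_eval_map _ _ _ _ _).trans ?_
  refine Eq.trans ?_ (evalAt_comp_eval_map _ _ _ _ (by rw [e']; exact w')).symm
  exact congrArg (fun k => k ≫ h) (evalAt_evalCompHom _ _ _ hw).symm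

variable (p q) in
/-- The polynomial functor of a composition product is the composite of the polynomial functors. -/
def evalComp : q.eval ⋙ p.eval ≅ (p.tri q).eval :=
  NatIso.ofComponents
    (fun A =>
      { hom := p.evalCompHom q A
        inv := p.evalCompInv q A
        hom_inv_id := evalCompHom_inv A
        inv_hom_id := evalCompInv_hom A })
    evalCompHom_naturality

end

/-! ### The monoidal structure -/

section

variable {p q p' q' : PolyIn E}

theorem triMap_fst (φ : p ⟶ p') (ψ : q ⟶ q') {B : E} (b : B ⟶ p.eval.obj q.pos)
    (t : B ⟶ triDir p' q')
    (w : b ≫ evalMapApp φ q.pos ≫ p'.eval.map ψ.onPos = t ≫ triProj p' q') :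
    (b ≫ p.evalFst q.pos) ≫ φ.onPos = (t ≫ p'.triFst q') ≫ p'.proj := by
  simpa [triProj_fst] using congrArg (fun k => k ≫ p'.evalFst q'.pos) w

theorem triMap_snd (φ : p ⟶ p') (ψ : q ⟶ q') {B : E} (b : B ⟶ p.eval.obj q.pos)
    (t : B ⟶ triDir p' q')
    (w : b ≫ evalMapApp φ q.pos ≫ p'.eval.map ψ.onPos = t ≫ triProj p' q') :
    p.evalAt b (φ.dirAt (b ≫ p.evalFst q.pos) (t ≫ p'.triFst q') (triMap_fst φ ψ b t w))
      (by simp) ≫ ψ.onPos = (t ≫ p'.triSnd q') ≫ q'.proj := by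
  rw [← triSnd_at (b ≫ evalMapApp φ q.pos ≫ p'.eval.map ψ.onPos) t w,
    p'.evalAt_congr (Category.assoc b (evalMapApp φ q.pos) (p'.eval.map ψ.onPos)).symm rfl,
    evalAt_comp_eval_map, evalAt_evalMapApp]

/-- The direction of `p.tri q` assigned by `φ` and `ψ` to a direction of `p'.tri q'`: apply `φ` to
the `p'`-direction and `ψ` to the `q'`-direction. -/
def triMapDir (φ : p ⟶ p') (ψ : q ⟶ q') {B : E} (b : B ⟶ p.eval.obj q.pos)
    (t : B ⟶ triDir p' q')
    (w : b ≫ evalMapApp φ q.pos ≫ p'.eval.map ψ.onPos = t ≫ triProj p' q') : B ⟶ triDir p q :=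
  triMk b (φ.dirAt (b ≫ p.evalFst q.pos) (t ≫ p'.triFst q') (triMap_fst φ ψ b t w))
    (ψ.dirAt (p.evalAt b (φ.dirAt (b ≫ p.evalFst q.pos) (t ≫ p'.triFst q')
      (triMap_fst φ ψ b t w)) (by simp)) (t ≫ p'.triSnd q') (triMap_snd φ ψ b t w))
    (by simp) (by simp)

/-- The composition product of morphisms of polynomials. -/
def triMap (φ : p ⟶ p') (ψ : q ⟶ q') : p.tri q ⟶ p'.tri q' where
  onPos := evalMapApp φ q.pos ≫ p'.eval.map ψ.onPos
  onDir := triMapDir φ ψ (pullback.fst _ (triProj p' q')) (pullback.snd _ (triProj p' q'))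
    pullback.condition
  onDir_proj := triMk_proj _ _ _ _ _

theorem triMap_dirAt (φ : p ⟶ p') (ψ : q ⟶ q') {B : E} (b : B ⟶ p.eval.obj q.pos)
    (t : B ⟶ triDir p' q')
    (w : b ≫ evalMapApp φ q.pos ≫ p'.eval.map ψ.onPos = t ≫ triProj p' q') :
    Hom.dirAt (triMap φ ψ) b t w = triMapDir φ ψ b t w := by
  refine comp_triMk_eq _ _ _ ?_ ?_ ?_
  · exact pullback.lift_fst _ _ _
  · exact φ.comp_dirAt_eq _ _ _ _ (pullback.lift_fst_assoc _ _ _ _) (pullback.lift_snd_assoc _ _ _ _)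
  · refine ψ.comp_dirAt_eq _ _ _ _ ?_ (pullback.lift_snd_assoc _ _ _ _)
    exact p.comp_evalAt_eq _ _ _ _ (pullback.lift_fst _ _ _)
      (φ.comp_dirAt_eq _ _ _ _ (pullback.lift_fst_assoc _ _ _ _) (pullback.lift_snd_assoc _ _ _ _))

theorem evalMapApp_triMap (φ : p ⟶ p') (ψ : q ⟶ q') (A : E) :
    p.evalCompHom q A ≫ evalMapApp (triMap φ ψ) A =
      evalMapApp φ (q.eval.obj A) ≫ p'.eval.map (evalMapApp ψ A) ≫ p'.evalCompHom q' A := by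
  have hpos : (p.evalCompHom q A ≫ evalMapApp (triMap φ ψ) A) ≫ (p'.tri q').evalFst A =
      p.eval.map (q.evalFst A) ≫ evalMapApp φ q.pos ≫ p'.eval.map ψ.onPos := by
    rw [Category.assoc, evalMapApp_fst, evalCompHom_fst_assoc]
    rfl
  refine eval_hom_ext _ (hpos.trans ?_) (fun b t w w' => ?_)
  · simp only [Category.assoc, evalCompHom_fst, evalMapApp_naturality_assoc, ← Functor.map_comp,
      evalMapApp_fst]
  · have e := Category.assoc b (p.evalCompHom q A) (evalMapApp (triMap φ ψ) A)
    have e₁ : ((b ≫ evalMapApp φ (q.eval.obj A)) ≫ p'.eval.map (evalMapApp ψ A)) ≫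
        p'.evalCompHom q' A = b ≫ evalMapApp φ (q.eval.obj A) ≫ p'.eval.map (evalMapApp ψ A) ≫
        p'.evalCompHom q' A := by simp only [Category.assoc]
    have h₁ : (b ≫ p.evalCompHom q A) ≫ (p.tri q).evalFst A = b ≫ p.eval.map (q.evalFst A) := by
      rw [Category.assoc, evalCompHom_fst]
    have w₂ : (b ≫ p.eval.map (q.evalFst A)) ≫ evalMapApp φ q.pos ≫ p'.eval.map ψ.onPos =
        t ≫ triProj p' q' := by
      rw [Category.assoc, ← hpos, ← Category.assoc]
      exact w
    have w₃ : ((b ≫ evalMapApp φ (q.eval.obj A)) ≫ p'.eval.map (evalMapApp ψ A)) ≫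
        p'.eval.map (q'.evalFst A) = t ≫ triProj p' q' := by
      simpa using w'
    have h₂ : Hom.dirAt (triMap φ ψ) ((b ≫ p.evalCompHom q A) ≫ (p.tri q).evalFst A) t
        (by rw [h₁]; exact w₂) = triMapDir φ ψ (b ≫ p.eval.map (q.evalFst A)) t w₂ :=
      (Hom.dirAt_congr _ h₁ rfl _).trans (triMap_dirAt φ ψ _ t w₂)
    have h₃ : φ.dirAt ((b ≫ p.eval.map (q.evalFst A)) ≫ p.evalFst q.pos) (t ≫ p'.triFst q')
        (triMap_fst φ ψ _ t w₂) = φ.dirAt (b ≫ p.evalFst (q.eval.obj A)) (t ≫ p'.triFst q')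
        (by simpa using triMap_fst φ ψ _ t w₂) :=
      φ.dirAt_congr (by simp) rfl _
    have h₄ : p'.evalAt ((b ≫ evalMapApp φ (q.eval.obj A)) ≫ p'.eval.map (evalMapApp ψ A))
        (t ≫ p'.triFst q') (evalComp_fst _ t w₃) =
        p.evalAt b (φ.dirAt (b ≫ p.evalFst (q.eval.obj A)) (t ≫ p'.triFst q')
        (by simpa using triMap_fst φ ψ _ t w₂)) (by simp) ≫ evalMapApp ψ A :=
      (evalAt_comp_eval_map _ _ _ _ _).trans
        (congrArg (fun k => k ≫ evalMapApp ψ A) (evalAt_evalMapApp _ _ _ _))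
    have w₄ := evalComp_snd _ t w₃
    rw [h₄] at w₄
    refine (evalAt_congr _ e.symm rfl _).trans (Eq.trans ?_ (evalAt_congr _ e₁ rfl
      (by rw [e₁]; exact w')))
    refine (evalAt_evalMapApp _ _ _ _).trans ?_
    refine (evalAt_congr _ rfl h₂ _).trans ?_
    refine (evalAt_evalCompHom _ _ _ (triMk_proj _ _ _ _ _).symm).trans ?_
    refine Eq.trans ?_ (evalAt_evalCompHom _ _ _ w₃).symm
    refine Eq.trans ?_ ((evalAt_congr _ h₄ rfl _).trans (evalAt_evalMapApp _ _ _ w₄)).symm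
    have h₅ : p.evalAt b (triMapDir φ ψ (b ≫ p.eval.map (q.evalFst A)) t w₂ ≫ p.triFst q)
        (evalComp_fst _ _ (triMk_proj _ _ _ _ _).symm) =
        p.evalAt b (φ.dirAt (b ≫ p.evalFst (q.eval.obj A)) (t ≫ p'.triFst q')
        (by simpa using triMap_fst φ ψ _ t w₂)) (by simp) :=
      evalAt_congr _ rfl ((triMk_fst _ _ _ _ _).trans h₃) _
    refine evalAt_congr _ h₅ ?_ _
    refine (triMk_snd _ _ _ _ _).trans (ψ.dirAt_congr ?_ rfl _)
    refine (evalAt_comp_eval_map _ _ _ _ _).trans ?_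
    exact congrArg (fun k => k ≫ q.evalFst A) (evalAt_congr _ rfl h₃ _)

end


section

variable {p q r : PolyIn E}

theorem assocHomDir_snd {B : E} (a : B ⟶ (p.tri q).eval.obj r.pos) (t : B ⟶ triDir p (q.tri r))
    (w : a ≫ p.evalCompInv q r.pos = t ≫ triProj p (q.tri r)) :
    p.evalAt (a ≫ p.evalCompInv q r.pos) (t ≫ p.triFst (q.tri r)) (triFst_at _ t w) =
      (t ≫ p.triSnd (q.tri r)) ≫ triProj q r :=
  triSnd_at _ t w

theorem assocHomDir_fst {B : E} (a : B ⟶ (p.tri q).eval.obj r.pos) (t : B ⟶ triDir p (q.tri r))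
    (w : a ≫ p.evalCompInv q r.pos = t ≫ triProj p (q.tri r)) :
    (a ≫ (p.tri q).evalFst r.pos) ≫ p.evalFst q.pos = (t ≫ p.triFst (q.tri r)) ≫ p.proj := by
  rw [Category.assoc, ← evalCompInv_fst, ← triFst_at _ t w, Category.assoc]

theorem assocHomDir_mid {B : E} (a : B ⟶ (p.tri q).eval.obj r.pos) (t : B ⟶ triDir p (q.tri r))
    (w : a ≫ p.evalCompInv q r.pos = t ≫ triProj p (q.tri r)) :
    p.evalAt (a ≫ (p.tri q).evalFst r.pos) (t ≫ p.triFst (q.tri r)) (assocHomDir_fst a t w) =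
      ((t ≫ p.triSnd (q.tri r)) ≫ q.triFst r) ≫ q.proj := by
  rw [← evalAt_evalCompInv_fst a _ (triFst_at _ t w), assocHomDir_snd a t w, Category.assoc,
    triProj_fst, ← Category.assoc]

theorem assocHomDir_last {B : E} (a : B ⟶ (p.tri q).eval.obj r.pos) (t : B ⟶ triDir p (q.tri r))
    (w : a ≫ p.evalCompInv q r.pos = t ≫ triProj p (q.tri r)) :
    (p.tri q).evalAt a (triMk (a ≫ (p.tri q).evalFst r.pos) (t ≫ p.triFst (q.tri r))
      ((t ≫ p.triSnd (q.tri r)) ≫ q.triFst r) (assocHomDir_fst a t w) (assocHomDir_mid a t w))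
      (triMk_proj _ _ _ _ _).symm =
      ((t ≫ p.triSnd (q.tri r)) ≫ q.triSnd r) ≫ r.proj := by
  refine (evalAt_evalAt_evalCompInv a _ _ (triFst_at _ t w) ?_).symm.trans ?_
  · rw [assocHomDir_snd a t w, Category.assoc, triProj_fst, ← Category.assoc]
  · exact triSnd_at _ _ (assocHomDir_snd a t w)

/-- Reassociation of directions. -/
def assocHomDir {B : E} (a : B ⟶ (p.tri q).eval.obj r.pos) (t : B ⟶ triDir p (q.tri r))
    (w : a ≫ p.evalCompInv q r.pos = t ≫ triProj p (q.tri r)) : B ⟶ triDir (p.tri q) r :=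
  triMk a (triMk (a ≫ (p.tri q).evalFst r.pos) (t ≫ p.triFst (q.tri r))
      ((t ≫ p.triSnd (q.tri r)) ≫ q.triFst r) (assocHomDir_fst a t w) (assocHomDir_mid a t w))
    ((t ≫ p.triSnd (q.tri r)) ≫ q.triSnd r) (triMk_proj _ _ _ _ _).symm (assocHomDir_last a t w)

/-- The direction triple of `assocHomDir` is that of `t`. -/
theorem comp_assocHomDir {B C : E} (u : C ⟶ B) (a : B ⟶ (p.tri q).eval.obj r.pos)
    (t : B ⟶ triDir p (q.tri r))
    (w : a ≫ p.evalCompInv q r.pos = t ≫ triProj p (q.tri r)) {a' : C ⟶ (p.tri q).eval.obj r.pos}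
    {t' : C ⟶ triDir p (q.tri r)} (ha : u ≫ a = a') (ht : u ≫ t = t') :
    u ≫ assocHomDir a t w = assocHomDir a' t' (by simp [← ha, ← ht, w]) := by
  subst ha ht
  exact comp_triMk_eq _ _ _ rfl (comp_triMk_eq _ _ _ (Category.assoc _ _ _).symm
    (Category.assoc _ _ _).symm (by simp only [Category.assoc])) (by simp only [Category.assoc])

section

variable {B : E} (a : B ⟶ (p.tri q).eval.obj r.pos) (t : B ⟶ triDir p (q.tri r))
    (w : a ≫ p.evalCompInv q r.pos = t ≫ triProj p (q.tri r))

theorem assocHomDir_proj : assocHomDir a t w ≫ triProj (p.tri q) r = a :=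
  triMk_proj _ _ _ _ _

theorem assocHomDir_fst_proj : (assocHomDir a t w ≫ (p.tri q).triFst r) ≫ triProj p q =
    a ≫ (p.tri q).evalFst r.pos :=
  (congrArg (fun k => k ≫ triProj p q) (triMk_fst _ _ _ _ _)).trans (triMk_proj _ _ _ _ _)

theorem assocHomDir_fst_fst : (assocHomDir a t w ≫ (p.tri q).triFst r) ≫ p.triFst q =
    t ≫ p.triFst (q.tri r) :=
  (congrArg (fun k => k ≫ p.triFst q) (triMk_fst _ _ _ _ _)).trans (triMk_fst _ _ _ _ _)

theorem assocHomDir_fst_snd : (assocHomDir a t w ≫ (p.tri q).triFst r) ≫ p.triSnd q =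
    (t ≫ p.triSnd (q.tri r)) ≫ q.triFst r :=
  (congrArg (fun k => k ≫ p.triSnd q) (triMk_fst _ _ _ _ _)).trans (triMk_snd _ _ _ _ _)

theorem assocHomDir_snd' : assocHomDir a t w ≫ (p.tri q).triSnd r =
    (t ≫ p.triSnd (q.tri r)) ≫ q.triSnd r :=
  triMk_snd _ _ _ _ _

end

variable (p q r) in
/-- The associator, from left to right. -/
def assocHom : (p.tri q).tri r ⟶ p.tri (q.tri r) where
  onPos := p.evalCompInv q r.pos
  onDir := assocHomDir (pullback.fst _ _) (pullback.snd _ _) pullback.condition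
  onDir_proj := triMk_proj _ _ _ _ _

theorem assocHom_dirAt {B : E} (a : B ⟶ (p.tri q).eval.obj r.pos) (t : B ⟶ triDir p (q.tri r))
    (w : a ≫ p.evalCompInv q r.pos = t ≫ triProj p (q.tri r)) :
    Hom.dirAt (assocHom p q r) a t w = assocHomDir a t w :=
  comp_assocHomDir _ _ _ pullback.condition (pullback.lift_fst _ _ _) (pullback.lift_snd _ _ _)

theorem assocInvDir_fst {B : E} (a : B ⟶ p.eval.obj (q.eval.obj r.pos))
    (t : B ⟶ triDir (p.tri q) r) (w : a ≫ p.evalCompHom q r.pos = t ≫ triProj (p.tri q) r) :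
    a ≫ p.eval.map (q.evalFst r.pos) = (t ≫ (p.tri q).triFst r) ≫ triProj p q :=
  (by simp : _ = (a ≫ p.evalCompHom q r.pos) ≫ (p.tri q).evalFst r.pos).trans (triFst_at _ t w)

theorem assocInvDir_last {B : E} (a : B ⟶ p.eval.obj (q.eval.obj r.pos))
    (t : B ⟶ triDir (p.tri q) r) (w : a ≫ p.evalCompHom q r.pos = t ≫ triProj (p.tri q) r) :
    q.evalAt (p.evalAt a ((t ≫ (p.tri q).triFst r) ≫ p.triFst q)
      (evalComp_fst a _ (assocInvDir_fst a t w))) ((t ≫ (p.tri q).triFst r) ≫ p.triSnd q)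
      (evalComp_snd a _ (assocInvDir_fst a t w)) = (t ≫ (p.tri q).triSnd r) ≫ r.proj :=
  (evalAt_evalCompHom a _ (triFst_at _ t w) (assocInvDir_fst a t w)).symm.trans (triSnd_at _ t w)

/-- Reassociation of directions, backwards. -/
def assocInvDir {B : E} (a : B ⟶ p.eval.obj (q.eval.obj r.pos))
    (t : B ⟶ triDir (p.tri q) r) (w : a ≫ p.evalCompHom q r.pos = t ≫ triProj (p.tri q) r) :
    B ⟶ triDir p (q.tri r) :=
  triMk a ((t ≫ (p.tri q).triFst r) ≫ p.triFst q)
    (triMk (p.evalAt a ((t ≫ (p.tri q).triFst r) ≫ p.triFst q)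
      (evalComp_fst a _ (assocInvDir_fst a t w))) ((t ≫ (p.tri q).triFst r) ≫ p.triSnd q)
      (t ≫ (p.tri q).triSnd r) (evalComp_snd a _ (assocInvDir_fst a t w))
      (assocInvDir_last a t w))
    (evalComp_fst a _ (assocInvDir_fst a t w)) (triMk_proj _ _ _ _ _).symm

theorem comp_assocInvDir {B C : E} (u : C ⟶ B) (a : B ⟶ p.eval.obj (q.eval.obj r.pos))
    (t : B ⟶ triDir (p.tri q) r) (w : a ≫ p.evalCompHom q r.pos = t ≫ triProj (p.tri q) r)
    {a' : C ⟶ p.eval.obj (q.eval.obj r.pos)} {t' : C ⟶ triDir (p.tri q) r}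
    (ha : u ≫ a = a') (ht : u ≫ t = t') :
    u ≫ assocInvDir a t w = assocInvDir a' t' (by simp [← ha, ← ht, w]) := by
  subst ha ht
  refine comp_triMk_eq _ _ _ rfl (by simp only [Category.assoc]) (comp_triMk_eq _ _ _ ?_
    (by simp only [Category.assoc]) (Category.assoc _ _ _).symm)
  exact comp_evalAt_eq _ _ _ _ _ rfl (by simp only [Category.assoc])

section

variable {B : E} (a : B ⟶ p.eval.obj (q.eval.obj r.pos)) (t : B ⟶ triDir (p.tri q) r)
    (w : a ≫ p.evalCompHom q r.pos = t ≫ triProj (p.tri q) r)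

theorem assocInvDir_proj : assocInvDir a t w ≫ triProj p (q.tri r) = a :=
  triMk_proj _ _ _ _ _

theorem assocInvDir_fst' : assocInvDir a t w ≫ p.triFst (q.tri r) =
    (t ≫ (p.tri q).triFst r) ≫ p.triFst q :=
  triMk_fst _ _ _ _ _

theorem assocInvDir_snd_proj : (assocInvDir a t w ≫ p.triSnd (q.tri r)) ≫ triProj q r =
    p.evalAt a ((t ≫ (p.tri q).triFst r) ≫ p.triFst q)
      (evalComp_fst a _ (assocInvDir_fst a t w)) :=
  (congrArg (fun k => k ≫ triProj q r) (triMk_snd _ _ _ _ _)).trans (triMk_proj _ _ _ _ _)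

theorem assocInvDir_snd_fst : (assocInvDir a t w ≫ p.triSnd (q.tri r)) ≫ q.triFst r =
    (t ≫ (p.tri q).triFst r) ≫ p.triSnd q :=
  (congrArg (fun k => k ≫ q.triFst r) (triMk_snd _ _ _ _ _)).trans (triMk_fst _ _ _ _ _)

theorem assocInvDir_snd_snd : (assocInvDir a t w ≫ p.triSnd (q.tri r)) ≫ q.triSnd r =
    t ≫ (p.tri q).triSnd r :=
  (congrArg (fun k => k ≫ q.triSnd r) (triMk_snd _ _ _ _ _)).trans (triMk_snd _ _ _ _ _)

end

variable (p q r) in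
/-- The associator, from right to left. -/
def assocInv : p.tri (q.tri r) ⟶ (p.tri q).tri r where
  onPos := p.evalCompHom q r.pos
  onDir := assocInvDir (pullback.fst _ _) (pullback.snd _ _) pullback.condition
  onDir_proj := triMk_proj _ _ _ _ _

theorem assocInv_dirAt {B : E} (a : B ⟶ p.eval.obj (q.eval.obj r.pos))
    (t : B ⟶ triDir (p.tri q) r) (w : a ≫ p.evalCompHom q r.pos = t ≫ triProj (p.tri q) r) :
    Hom.dirAt (assocInv p q r) a t w = assocInvDir a t w :=
  comp_assocInvDir _ _ _ pullback.condition (pullback.lift_fst _ _ _) (pullback.lift_snd _ _ _)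

theorem assocHomDir_assocInvDir {B : E} (a : B ⟶ (p.tri q).eval.obj r.pos)
    (t : B ⟶ triDir (p.tri q) r) (ha : a = t ≫ triProj (p.tri q) r)
    (w : (a ≫ p.evalCompInv q r.pos) ≫ p.evalCompHom q r.pos = t ≫ triProj (p.tri q) r) :
    assocHomDir a (assocInvDir (a ≫ p.evalCompInv q r.pos) t w) (assocInvDir_proj _ _ _).symm =
      t := by
  refine tri_hom_ext ((assocHomDir_proj _ _ _).trans ha) (tri_hom_ext ?_ ?_ ?_) ?_
  · exact (assocHomDir_fst_proj _ _ _).trans (triFst_at _ t ha)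
  · exact (assocHomDir_fst_fst _ _ _).trans (assocInvDir_fst' _ _ _)
  · exact (assocHomDir_fst_snd _ _ _).trans (assocInvDir_snd_fst _ _ _)
  · exact (assocHomDir_snd' _ _ _).trans (assocInvDir_snd_snd _ _ _)

theorem assocInvDir_assocHomDir {B : E} (a : B ⟶ p.eval.obj (q.eval.obj r.pos))
    (t : B ⟶ triDir p (q.tri r)) (ha : a = t ≫ triProj p (q.tri r))
    (w : (a ≫ p.evalCompHom q r.pos) ≫ p.evalCompInv q r.pos = t ≫ triProj p (q.tri r)) :
    assocInvDir a (assocHomDir (a ≫ p.evalCompHom q r.pos) t w) (assocHomDir_proj _ _ _).symm =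
      t := by
  refine tri_hom_ext ((assocInvDir_proj _ _ _).trans ha) ?_ (tri_hom_ext ?_ ?_ ?_)
  · exact (assocInvDir_fst' _ _ _).trans (assocHomDir_fst_fst _ _ _)
  · refine (assocInvDir_snd_proj _ _ _).trans ?_
    exact (evalAt_congr _ rfl (assocHomDir_fst_fst _ _ _) _).trans (triSnd_at _ t ha)
  · exact (assocInvDir_snd_fst _ _ _).trans (assocHomDir_fst_snd _ _ _)
  · exact (assocInvDir_snd_snd _ _ _).trans (assocHomDir_snd' _ _ _)

theorem assocHom_assocInv : assocHom p q r ≫ assocInv p q r = 𝟙 _ := by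
  refine Hom.ext_dirAt (evalCompInv_hom _) (fun a t w w' => ?_)
  have ha : a = t ≫ triProj (p.tri q) r := (Category.comp_id a).symm.trans w'
  have hw : (a ≫ p.evalCompInv q r.pos) ≫ p.evalCompHom q r.pos = t ≫ triProj (p.tri q) r :=
    (Category.assoc _ _ _).trans w
  have h := assocInv_dirAt (a ≫ p.evalCompInv q r.pos) t hw
  have h₂ := assocHom_dirAt a _ (assocInvDir_proj (a ≫ p.evalCompInv q r.pos) t hw).symm
  have h₃ := assocHomDir_assocInvDir a t ha hw
  exact ((comp_dirAt _ _ _ _ _).trans ((Hom.dirAt_congr _ rfl h _).trans h₂)).trans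
    (h₃.trans (id_dirAt _ _ _ _).symm)

theorem assocInv_assocHom : assocInv p q r ≫ assocHom p q r = 𝟙 _ := by
  refine Hom.ext_dirAt (evalCompHom_inv _) (fun a t w w' => ?_)
  have ha : a = t ≫ triProj p (q.tri r) := (Category.comp_id a).symm.trans w'
  have hw : (a ≫ p.evalCompHom q r.pos) ≫ p.evalCompInv q r.pos = t ≫ triProj p (q.tri r) :=
    (Category.assoc _ _ _).trans w
  have h := assocHom_dirAt (a ≫ p.evalCompHom q r.pos) t hw
  have h₂ := assocInv_dirAt a _ (assocHomDir_proj (a ≫ p.evalCompHom q r.pos) t hw).symm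
  have h₃ := assocInvDir_assocHomDir a t ha hw
  exact ((comp_dirAt _ _ _ _ _).trans ((Hom.dirAt_congr _ rfl h _).trans h₂)).trans
    (h₃.trans (id_dirAt _ _ _ _).symm)

variable (p q r) in
/-- The associator. -/
def assoc : (p.tri q).tri r ≅ p.tri (q.tri r) where
  hom := assocHom p q r
  inv := assocInv p q r
  hom_inv_id := assocHom_assocInv
  inv_hom_id := assocInv_assocHom

end

section

variable {p q r : PolyIn E}

theorem evalCompInv_naturality {A A' : E} (h : A ⟶ A') :
    (p.tri q).eval.map h ≫ p.evalCompInv q A' =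
      p.evalCompInv q A ≫ p.eval.map (q.eval.map h) :=
  (evalComp p q).inv.naturality h

theorem evalCompInv_naturality_assoc {A A' Z : E} (h : A ⟶ A')
    (k : p.eval.obj (q.eval.obj A') ⟶ Z) :
    (p.tri q).eval.map h ≫ p.evalCompInv q A' ≫ k =
      p.evalCompInv q A ≫ p.eval.map (q.eval.map h) ≫ k := by
  rw [← Category.assoc, evalCompInv_naturality, Category.assoc]

theorem evalMapApp_assocHom (A : E) :
    (p.tri q).evalCompHom r A ≫ evalMapApp (assocHom p q r) A =
      p.evalCompInv q (r.eval.obj A) ≫ p.eval.map (q.evalCompHom r A) ≫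
        p.evalCompHom (q.tri r) A := by
  have hpos : ((p.tri q).evalCompHom r A ≫ evalMapApp (assocHom p q r) A) ≫
      (p.tri (q.tri r)).evalFst A = (p.tri q).eval.map (r.evalFst A) ≫ p.evalCompInv q r.pos := by
    rw [Category.assoc, evalMapApp_fst, evalCompHom_fst_assoc]
    rfl
  refine eval_hom_ext _ (hpos.trans ?_) (fun b t w w' => ?_)
  · simp only [Category.assoc, evalCompHom_fst, evalCompInv_naturality, ← Functor.map_comp]
  have e₁ : (b ≫ (p.tri q).evalCompHom r A) ≫ evalMapApp (assocHom p q r) A =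
      b ≫ (p.tri q).evalCompHom r A ≫ evalMapApp (assocHom p q r) A := Category.assoc _ _ _
  have e₂ : ((b ≫ p.evalCompInv q (r.eval.obj A)) ≫ p.eval.map (q.evalCompHom r A)) ≫
      p.evalCompHom (q.tri r) A = b ≫ p.evalCompInv q (r.eval.obj A) ≫
        p.eval.map (q.evalCompHom r A) ≫ p.evalCompHom (q.tri r) A := by simp only [Category.assoc]
  have hw : (b ≫ (p.tri q).eval.map (r.evalFst A)) ≫ p.evalCompInv q r.pos =
      t ≫ triProj p (q.tri r) := by
    rw [Category.assoc, ← hpos, ← Category.assoc]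
    exact w
  have hb : (b ≫ (p.tri q).evalCompHom r A) ≫ ((p.tri q).tri r).evalFst A =
      b ≫ (p.tri q).eval.map (r.evalFst A) := by
    rw [Category.assoc, evalCompHom_fst]
  have h₁ : Hom.dirAt (assocHom p q r)
      ((b ≫ (p.tri q).evalCompHom r A) ≫ ((p.tri q).tri r).evalFst A) t
      (by rw [hb]; exact hw) = assocHomDir (b ≫ (p.tri q).eval.map (r.evalFst A)) t hw :=
    (Hom.dirAt_congr _ hb rfl _).trans (assocHom_dirAt _ t hw)
  have hx : (b ≫ p.evalCompInv q (r.eval.obj A)) ≫ p.evalFst (q.eval.obj (r.eval.obj A)) =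
      (t ≫ p.triFst (q.tri r)) ≫ p.proj := by
    rw [Category.assoc t, ← triProj_fst, ← reassoc_of% hw]
    simp
  have hv : ((b ≫ p.evalCompInv q (r.eval.obj A)) ≫ p.eval.map (q.evalCompHom r A)) ≫
      p.eval.map ((q.tri r).evalFst A) = t ≫ triProj p (q.tri r) := by
    rw [← hw]
    simp only [Category.assoc, evalCompInv_naturality, ← Functor.map_comp, evalCompHom_fst]
  have h₂ := (p.evalAt_comp_eval_map (b ≫ p.evalCompInv q (r.eval.obj A))
    (t ≫ p.triFst (q.tri r)) (q.evalCompHom r A) (evalComp_fst _ _ hv))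
  have hs := evalComp_snd _ t hv
  rw [h₂] at hs
  have hs' : p.evalAt (b ≫ p.evalCompInv q (r.eval.obj A)) (t ≫ p.triFst (q.tri r)) hx ≫
      q.eval.map (r.evalFst A) = (t ≫ p.triSnd (q.tri r)) ≫ triProj q r := by
    refine Eq.trans ?_ hs
    rw [Category.assoc, evalCompHom_fst]
  have hp₁ := (assocHomDir_proj (b ≫ (p.tri q).eval.map (r.evalFst A)) t hw).symm
  have L := (evalAt_congr _ e₁.symm rfl w).trans ((evalAt_evalMapApp _ _ _ _).trans
    ((evalAt_congr _ rfl h₁ _).trans (evalAt_evalCompHom b _ (by rw [← hp₁, hb]) hp₁)))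
  have R := (evalAt_congr _ e₂.symm rfl w').trans ((evalAt_evalCompHom _ t _ hv).trans
    ((evalAt_congr _ h₂ rfl _).trans (evalAt_evalCompHom _ _ hs hs')))
  refine L.trans (Eq.trans ?_ R.symm)
  refine evalAt_congr _ ?_ (assocHomDir_snd' _ _ _) _
  refine Eq.trans ?_ (evalAt_evalAt_evalCompInv b _ _ hx (evalComp_fst _ _ hs')).symm
  refine evalAt_congr _ rfl (tri_hom_ext ?_ ?_ ?_) _
  · refine (assocHomDir_fst_proj _ _ _).trans (Eq.trans ?_ (triMk_proj _ _ _ _ _).symm)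
    rw [Category.assoc, eval_map_fst]
  · exact (assocHomDir_fst_fst _ _ _).trans (triMk_fst _ _ _ _ _).symm
  · exact (assocHomDir_fst_snd _ _ _).trans (triMk_snd _ _ _ _ _).symm

theorem comp_evalUnit_hom {A B : E} (z : B ⟶ (unit E).eval.obj A) (x : B ⟶ ⊤_ E) :
    (unit E).evalAt z x (Subsingleton.elim _ _) = z ≫ evalUnit.hom.app A :=
  (comp_evalAt_eq _ _ _ _ _ (Category.comp_id _) (Subsingleton.elim _ _)).symm

variable (p) in
/-- The left unitor, from left to right. -/
def leftHom : (unit E).tri p ⟶ p where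
  onPos := evalUnit.hom.app p.pos
  onDir := triMk (pullback.fst _ _) (terminal.from _) (pullback.snd _ _)
    (Subsingleton.elim _ _) ((comp_evalUnit_hom _ _).trans pullback.condition)
  onDir_proj := triMk_proj _ _ _ _ _

theorem leftHom_dirAt {B : E} (a : B ⟶ (unit E).eval.obj p.pos) (y : B ⟶ p.dir)
    (w : a ≫ evalUnit.hom.app p.pos = y ≫ p.proj) :
    Hom.dirAt (leftHom p) a y w = triMk a (terminal.from _) y
      (Subsingleton.elim _ _) ((comp_evalUnit_hom _ _).trans w) :=
  comp_triMk_eq _ _ _ (pullback.lift_fst _ _ _) (Subsingleton.elim _ _) (pullback.lift_snd _ _ _)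

variable (p) in
/-- The left unitor, from right to left. -/
def leftInv : p ⟶ (unit E).tri p where
  onPos := evalUnit.inv.app p.pos
  onDir := pullback.snd _ _ ≫ triSnd (unit E) p
  onDir_proj := by
    have h := triSnd_at _ (pullback.snd (evalUnit.inv.app p.pos) (triProj (unit E) p))
      pullback.condition
    refine h.symm.trans ?_
    exact (evalAt_evalMk _ _ _ _ _ _).trans (pullback.lift_fst _ _ _)

theorem leftInv_dirAt {B : E} (b : B ⟶ p.pos) (t : B ⟶ triDir (unit E) p)
    (w : b ≫ evalUnit.inv.app p.pos = t ≫ triProj (unit E) p) :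
    Hom.dirAt (leftInv p) b t w = t ≫ triSnd (unit E) p :=
  pullback.lift_snd_assoc _ _ _ _

variable (p) in
/-- The left unitor. -/
def leftUnit : (unit E).tri p ≅ p where
  hom := leftHom p
  inv := leftInv p
  hom_inv_id := by
    refine Hom.ext_dirAt (evalUnit.hom_inv_id_app p.pos) (fun a t w w' => ?_)
    have ha : a = t ≫ triProj (unit E) p := (Category.comp_id a).symm.trans w'
    have h₁ := leftInv_dirAt (a ≫ evalUnit.hom.app p.pos) t ((Category.assoc _ _ _).trans w)
    have hy : a ≫ evalUnit.hom.app p.pos = (t ≫ triSnd (unit E) p) ≫ p.proj :=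
      (comp_evalUnit_hom _ _).symm.trans (triSnd_at a t ha)
    refine ((comp_dirAt _ _ _ _ _).trans ((Hom.dirAt_congr _ rfl h₁ _).trans
      (leftHom_dirAt a _ hy))).trans (Eq.trans ?_ (id_dirAt _ _ _ _).symm)
    exact tri_hom_ext ((triMk_proj _ _ _ _ _).trans ha) (Subsingleton.elim _ _)
      (triMk_snd _ _ _ _ _)
  inv_hom_id := by
    refine Hom.ext_dirAt (evalUnit.inv_hom_id_app p.pos) (fun b y w w' => ?_)
    have h₁ := leftHom_dirAt (b ≫ evalUnit.inv.app p.pos) y ((Category.assoc _ _ _).trans w)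
    refine ((comp_dirAt _ _ _ _ _).trans ((Hom.dirAt_congr _ rfl h₁ _).trans
      (leftInv_dirAt b _ (triMk_proj _ _ _ _ _).symm))).trans
        (Eq.trans ?_ (id_dirAt _ _ _ _).symm)
    exact triMk_snd _ _ _ _ _

variable (p) in
/-- The right unitor, from left to right. -/
def rightHom : p.tri (unit E) ⟶ p where
  onPos := p.evalFst (⊤_ E)
  onDir := triMk (pullback.fst _ _) (pullback.snd _ _) (terminal.from _) pullback.condition
    (Subsingleton.elim _ _)
  onDir_proj := triMk_proj _ _ _ _ _

theorem rightHom_dirAt {B : E} (a : B ⟶ p.eval.obj (⊤_ E)) (x : B ⟶ p.dir)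
    (w : a ≫ p.evalFst (⊤_ E) = x ≫ p.proj) :
    Hom.dirAt (rightHom p) a x w = triMk (q := unit E) a x (terminal.from _) w
      (Subsingleton.elim _ _) :=
  comp_triMk_eq _ _ _ (pullback.lift_fst _ _ _) (pullback.lift_snd _ _ _) (Subsingleton.elim _ _)

variable (p) in
/-- The right unitor, from right to left. -/
def rightInv : p ⟶ p.tri (unit E) where
  onPos := p.evalMk (𝟙 _) (terminal.from _)
  onDir := pullback.snd _ _ ≫ triFst p (unit E)
  onDir_proj := by
    have h := triFst_at _ (pullback.snd (p.evalMk (𝟙 _) (terminal.from _)) (triProj p (unit E)))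
      pullback.condition
    exact h.symm.trans (by simp)

theorem rightInv_dirAt {B : E} (b : B ⟶ p.pos) (t : B ⟶ triDir p (unit E))
    (w : b ≫ p.evalMk (𝟙 _) (terminal.from _) = t ≫ triProj p (unit E)) :
    Hom.dirAt (rightInv p) b t w = t ≫ triFst p (unit E) :=
  pullback.lift_snd_assoc _ _ _ _

theorem eval_terminal_ext {B : E} {z z' : B ⟶ p.eval.obj (⊤_ E)}
    (h : z ≫ p.evalFst _ = z' ≫ p.evalFst _) : z = z' :=
  eval_hom_ext _ h (fun _ _ _ _ => Subsingleton.elim _ _)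

variable (p) in
/-- The right unitor. -/
def rightUnit : p.tri (unit E) ≅ p where
  hom := rightHom p
  inv := rightInv p
  hom_inv_id := by
    have e : p.evalFst (⊤_ E) ≫ p.evalMk (𝟙 _) (terminal.from _) = 𝟙 _ :=
      eval_terminal_ext (by simp)
    refine Hom.ext_dirAt e (fun a t w w' => ?_)
    have ha : a = t ≫ triProj p (unit E) := (Category.comp_id a).symm.trans w'
    have h₁ := rightInv_dirAt (a ≫ p.evalFst (⊤_ E)) t ((Category.assoc _ _ _).trans w)
    refine ((comp_dirAt _ _ _ _ _).trans ((Hom.dirAt_congr _ rfl h₁ _).trans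
      (rightHom_dirAt a _ (triFst_at a t ha)))).trans (Eq.trans ?_ (id_dirAt _ _ _ _).symm)
    exact tri_hom_ext ((triMk_proj _ _ _ _ _).trans ha) (triMk_fst _ _ _ _ _)
      (Subsingleton.elim _ _)
  inv_hom_id := by
    refine Hom.ext_dirAt (evalMk_fst _ _ _) (fun b x w w' => ?_)
    have h₁ := rightHom_dirAt (b ≫ p.evalMk (𝟙 _) (terminal.from _)) x
      ((Category.assoc _ _ _).trans w)
    have h₂ := rightInv_dirAt b _ (triMk_proj (q := unit E) (b ≫ p.evalMk (𝟙 _) (terminal.from _))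
      x (terminal.from _) ((Category.assoc _ _ _).trans w) (Subsingleton.elim _ _)).symm
    have h₃ := triMk_fst (q := unit E) (b ≫ p.evalMk (𝟙 _) (terminal.from _))
      x (terminal.from _) ((Category.assoc _ _ _).trans w) (Subsingleton.elim _ _)
    exact ((comp_dirAt _ _ _ _ _).trans ((Hom.dirAt_congr _ rfl h₁ _).trans h₂)).trans
        (h₃.trans (id_dirAt _ _ _ _).symm)

theorem evalMapApp_leftHom (A : E) :
    (unit E).evalCompHom p A ≫ evalMapApp (leftHom p) A = evalUnit.hom.app (p.eval.obj A) := by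
  have hpos : ((unit E).evalCompHom p A ≫ evalMapApp (leftHom p) A) ≫ p.evalFst A =
      (unit E).eval.map (p.evalFst A) ≫ evalUnit.hom.app p.pos := by
    rw [Category.assoc, evalMapApp_fst, evalCompHom_fst_assoc]
    rfl
  refine eval_hom_ext _ (hpos.trans (evalUnit.hom.naturality _)) (fun b y w w' => ?_)
  have hb : (b ≫ (unit E).evalCompHom p A) ≫ ((unit E).tri p).evalFst A =
      b ≫ (unit E).eval.map (p.evalFst A) := by
    rw [Category.assoc, evalCompHom_fst]
  have hw : (b ≫ (unit E).eval.map (p.evalFst A)) ≫ evalUnit.hom.app p.pos = y ≫ p.proj := by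
    rw [Category.assoc, ← hpos, ← Category.assoc]
    exact w
  have h₁ : Hom.dirAt (leftHom p) ((b ≫ (unit E).evalCompHom p A) ≫ ((unit E).tri p).evalFst A) y
      (by rw [hb]; exact hw) = triMk (b ≫ (unit E).eval.map (p.evalFst A)) (terminal.from _) y
      (Subsingleton.elim _ _) ((comp_evalUnit_hom _ _).trans hw) :=
    (Hom.dirAt_congr _ hb rfl _).trans (leftHom_dirAt _ y hw)
  have hp₁ := (triMk_proj (b ≫ (unit E).eval.map (p.evalFst A)) (terminal.from _) y
      (Subsingleton.elim _ _) ((comp_evalUnit_hom _ _).trans hw)).symm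
  have L := (evalAt_congr _ (Category.assoc _ _ _).symm rfl w).trans
    ((evalAt_evalMapApp _ _ _ _).trans
    ((evalAt_congr _ rfl h₁ _).trans (evalAt_evalCompHom b _ (by rw [← hp₁, hb]) hp₁)))
  refine L.trans ?_
  exact evalAt_congr _ (comp_evalUnit_hom _ _) (triMk_snd _ _ _ _ _) _

theorem evalMapApp_rightHom (A : E) :
    p.evalCompHom (unit E) A ≫ evalMapApp (rightHom p) A = p.eval.map (evalUnit.hom.app A) := by
  have hpos : (p.evalCompHom (unit E) A ≫ evalMapApp (rightHom p) A) ≫ p.evalFst A =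
      p.eval.map ((unit E).evalFst A) ≫ p.evalFst (⊤_ E) := by
    rw [Category.assoc, evalMapApp_fst, evalCompHom_fst_assoc]
    rfl
  refine eval_hom_ext _ (hpos.trans (by simp)) (fun b x w w' => ?_)
  have hb : (b ≫ p.evalCompHom (unit E) A) ≫ (p.tri (unit E)).evalFst A =
      b ≫ p.eval.map ((unit E).evalFst A) := by
    rw [Category.assoc, evalCompHom_fst]
  have hw : (b ≫ p.eval.map ((unit E).evalFst A)) ≫ p.evalFst (⊤_ E) = x ≫ p.proj := by
    rw [Category.assoc, ← hpos, ← Category.assoc]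
    exact w
  have h₁ : Hom.dirAt (rightHom p) ((b ≫ p.evalCompHom (unit E) A) ≫
      (p.tri (unit E)).evalFst A) x (by rw [hb]; exact hw) =
      triMk (q := unit E) (b ≫ p.eval.map ((unit E).evalFst A)) x (terminal.from _) hw
      (Subsingleton.elim _ _) :=
    (Hom.dirAt_congr _ hb rfl _).trans (rightHom_dirAt _ x hw)
  have hp₁ := (triMk_proj (q := unit E) (b ≫ p.eval.map ((unit E).evalFst A)) x (terminal.from _)
    hw (Subsingleton.elim _ _)).symm
  have L := (evalAt_congr _ (Category.assoc _ _ _).symm rfl w).trans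
    ((evalAt_evalMapApp _ _ _ _).trans
    ((evalAt_congr _ rfl h₁ _).trans (evalAt_evalCompHom b _ (by rw [← hp₁, hb]) hp₁)))
  refine L.trans (Eq.trans ?_ (evalAt_comp_eval_map _ _ _ _ _).symm)
  refine (comp_evalUnit_hom _ _).trans ?_
  exact congrArg (fun k => k ≫ evalUnit.hom.app A) (evalAt_congr _ rfl (triMk_fst _ _ _ _ _) _)

end

section

variable {p q r : PolyIn E}

theorem hom_ext_app {φ ψ : p ⟶ q} (h : ∀ A, evalMapApp φ A = evalMapApp ψ A) : φ = ψ :=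
  evalMap_injective (NatTrans.ext (funext h))

theorem evalMapApp_id (A : E) : evalMapApp (𝟙 p) A = 𝟙 _ :=
  congrArg (fun k => k.app A) (evalMap_id p)

theorem evalMapApp_comp (φ : p ⟶ q) (ψ : q ⟶ r) (A : E) :
    evalMapApp (φ ≫ ψ) A = evalMapApp φ A ≫ evalMapApp ψ A :=
  congrArg (fun k => k.app A) (evalMap_comp φ ψ)

theorem evalMapApp_triMap_eq {p' q' : PolyIn E} (φ : p ⟶ p') (ψ : q ⟶ q') (A : E) :
    evalMapApp (triMap φ ψ) A = p.evalCompInv q A ≫ evalMapApp φ (q.eval.obj A) ≫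
      p'.eval.map (evalMapApp ψ A) ≫ p'.evalCompHom q' A := by
  rw [← evalMapApp_triMap, evalCompInv_hom_assoc]

theorem evalMapApp_assoc_hom (A : E) :
    evalMapApp (assoc p q r).hom A = (p.tri q).evalCompInv r A ≫ p.evalCompInv q (r.eval.obj A) ≫
      p.eval.map (q.evalCompHom r A) ≫ p.evalCompHom (q.tri r) A := by
  rw [← evalMapApp_assocHom, evalCompInv_hom_assoc]
  rfl

theorem evalMapApp_leftUnit_hom (A : E) :
    evalMapApp (leftUnit p).hom A =
      (unit E).evalCompInv p A ≫ evalUnit.hom.app (p.eval.obj A) := by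
  rw [← evalMapApp_leftHom, evalCompInv_hom_assoc]
  rfl

theorem evalMapApp_rightUnit_hom (A : E) :
    evalMapApp (rightUnit p).hom A =
      p.evalCompInv (unit E) A ≫ p.eval.map (evalUnit.hom.app A) := by
  rw [← evalMapApp_rightHom, evalCompInv_hom_assoc]
  rfl

theorem map_evalCompHom_inv (s : PolyIn E) (A : E) :
    s.eval.map (p.evalCompHom q A) ≫ s.eval.map (p.evalCompInv q A) = 𝟙 _ := by
  rw [← Functor.map_comp, evalCompHom_inv, Functor.map_id]

theorem map_evalCompHom_inv_assoc (s : PolyIn E) (A : E) {Z : E}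
    (k : s.eval.obj (p.eval.obj (q.eval.obj A)) ⟶ Z) :
    s.eval.map (p.evalCompHom q A) ≫ s.eval.map (p.evalCompInv q A) ≫ k = k := by
  rw [← Category.assoc, map_evalCompHom_inv, Category.id_comp]

end

instance : MonoidalCategoryStruct (PolyIn E) where
  tensorObj := tri
  whiskerLeft p _ _ φ := triMap (𝟙 p) φ
  whiskerRight φ q := triMap φ (𝟙 q)
  tensorHom := triMap
  tensorUnit := unit E
  associator := assoc
  leftUnitor := leftUnit
  rightUnitor := rightUnit

theorem triMap_id (p q : PolyIn E) : triMap (𝟙 p) (𝟙 q) = 𝟙 (p.tri q) :=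
  hom_ext_app fun A => by simp [evalMapApp_triMap_eq, evalMapApp_id]

theorem triMap_comp {p p' p'' q q' q'' : PolyIn E} (φ : p ⟶ p') (ψ : q ⟶ q') (φ' : p' ⟶ p'')
    (ψ' : q' ⟶ q'') : triMap φ ψ ≫ triMap φ' ψ' = triMap (φ ≫ φ') (ψ ≫ ψ') :=
  hom_ext_app fun A => by
    simp [evalMapApp_triMap_eq, evalMapApp_comp, evalMapApp_naturality_assoc]

theorem assoc_naturality {p p' q q' r r' : PolyIn E} (φ : p ⟶ p') (ψ : q ⟶ q') (χ : r ⟶ r') :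
    triMap (triMap φ ψ) χ ≫ (assoc p' q' r').hom =
      (assoc p q r).hom ≫ triMap φ (triMap ψ χ) :=
  hom_ext_app fun A => by
    simp only [evalMapApp_triMap_eq, evalMapApp_comp, evalMapApp_assoc_hom, Category.assoc,
      evalCompHom_inv_assoc, evalCompInv_naturality_assoc, evalMapApp_naturality_assoc,
      Functor.map_comp, map_evalCompHom_inv_assoc]

theorem leftUnit_naturality {p q : PolyIn E} (φ : p ⟶ q) :
    triMap (𝟙 (unit E)) φ ≫ (leftUnit q).hom = (leftUnit p).hom ≫ φ :=
  hom_ext_app fun A => by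
    simp [evalMapApp_triMap_eq, evalMapApp_comp, evalMapApp_id, evalMapApp_leftUnit_hom]

theorem rightUnit_naturality {p q : PolyIn E} (φ : p ⟶ q) :
    triMap φ (𝟙 (unit E)) ≫ (rightUnit q).hom = (rightUnit p).hom ≫ φ :=
  hom_ext_app fun A => by
    simp [evalMapApp_triMap_eq, evalMapApp_comp, evalMapApp_id, evalMapApp_rightUnit_hom,
      evalMapApp_naturality]

theorem pentagon (p q r s : PolyIn E) :
    triMap (assoc p q r).hom (𝟙 s) ≫ (assoc p (q.tri r) s).hom ≫
      triMap (𝟙 p) (assoc q r s).hom = (assoc (p.tri q) r s).hom ≫ (assoc p q (r.tri s)).hom :=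
  hom_ext_app fun A => by
    simp only [evalMapApp_triMap_eq, evalMapApp_comp, evalMapApp_id, evalMapApp_assoc_hom,
      Category.assoc, Functor.map_id, Category.id_comp, evalCompHom_inv_assoc, Functor.map_comp,
      evalCompInv_naturality_assoc, map_evalCompHom_inv_assoc]

theorem triangle (p q : PolyIn E) :
    (assoc p (unit E) q).hom ≫ triMap (𝟙 p) (leftUnit q).hom = triMap (rightUnit p).hom (𝟙 q) :=
  hom_ext_app fun A => by
    simp only [evalMapApp_triMap_eq, evalMapApp_comp, evalMapApp_id, evalMapApp_assoc_hom,
      evalMapApp_leftUnit_hom, evalMapApp_rightUnit_hom,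
      Category.assoc, Functor.map_id, Category.id_comp, evalCompHom_inv_assoc, Functor.map_comp,
      map_evalCompHom_inv_assoc]

/-- The monoidal category of polynomials, with the composition product. -/
instance : MonoidalCategory (PolyIn E) :=
  MonoidalCategory.ofTensorHom triMap_id (fun _ _ _ _ => rfl) (fun _ _ => rfl) triMap_comp
    assoc_naturality leftUnit_naturality rightUnit_naturality pentagon triangle

end PolyIn

open MonoidalCategory

section
open scoped ComonObj

/-- A bicomodule over comonoids `c` and `d` in a monoidal category: an object with a left
coaction of `c` and a right coaction of `d`, each counital and coassociative, which commute. -/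
structure Bicomodule {C : Type u} [Category.{v} C] [MonoidalCategory C] (c d : Comon C) where
  /-- the underlying object -/
  X : C
  /-- the left coaction -/
  left : X ⟶ c.X ⊗ X
  /-- the right coaction -/
  right : X ⟶ X ⊗ d.X
  left_counit : left ≫ ε[c.X] ▷ X = (λ_ X).inv
  left_coassoc : left ≫ c.X ◁ left = left ≫ Δ[c.X] ▷ X ≫ (α_ c.X c.X X).hom
  right_counit : right ≫ X ◁ ε[d.X] = (ρ_ X).inv
  right_coassoc : right ≫ X ◁ Δ[d.X] = right ≫ right ▷ d.X ≫ (α_ X d.X d.X).hom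
  compat : left ≫ c.X ◁ right = right ≫ left ▷ d.X ≫ (α_ c.X X d.X).hom

end

namespace PolyIn

variable [HasFiniteLimits E]

/-- The comultiplication of the comonad of a comonoid in polynomials. -/
def comonadComul (c : Comon (PolyIn E)) : c.X.eval ⟶ c.X.eval ⋙ c.X.eval :=
  evalMap ComonObj.comul ≫ (evalComp c.X c.X).inv

/-- The counit of the comonad of a comonoid in polynomials. -/
def comonadCounit (c : Comon (PolyIn E)) : c.X.eval ⟶ 𝟭 E :=
  evalMap ComonObj.counit ≫ evalUnit.hom

theorem comonad_coassoc (c : Comon (PolyIn E)) (A : E) :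
    (comonadComul c).app A ≫ c.X.eval.map ((comonadComul c).app A) =
      (comonadComul c).app A ≫ (comonadComul c).app (c.X.eval.obj A) := by
  let δ : c.X ⟶ c.X.tri c.X := ComonObj.comul
  have h₁ : δ ≫ triMap (𝟙 c.X) δ = δ ≫ triMap δ (𝟙 c.X) ≫ (assoc c.X c.X c.X).hom :=
    ComonObj.comul_assoc c.X
  have h₂ := congrArg (fun φ => evalMapApp φ A ≫ c.X.evalCompInv (c.X.tri c.X) A ≫
    c.X.eval.map (c.X.evalCompInv c.X A)) h₁
  simp only [evalMapApp_comp, evalMapApp_triMap_eq, evalMapApp_id, evalMapApp_assoc_hom,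
    Category.assoc, Category.id_comp, Functor.map_id, evalCompHom_inv_assoc,
    map_evalCompHom_inv, Category.comp_id] at h₂
  change (evalMapApp δ A ≫ c.X.evalCompInv c.X A) ≫
    c.X.eval.map (evalMapApp δ A ≫ c.X.evalCompInv c.X A) =
    (evalMapApp δ A ≫ c.X.evalCompInv c.X A) ≫ evalMapApp δ (c.X.eval.obj A) ≫
      c.X.evalCompInv c.X (c.X.eval.obj A)
  simpa only [Category.assoc, Functor.map_comp] using h₂

theorem comonad_left_counit (c : Comon (PolyIn E)) (A : E) :
    (comonadComul c).app A ≫ (comonadCounit c).app (c.X.eval.obj A) = 𝟙 (c.X.eval.obj A) := by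
  let δ : c.X ⟶ c.X.tri c.X := ComonObj.comul
  let ε : c.X ⟶ unit E := ComonObj.counit
  have h₁ : (δ ≫ triMap ε (𝟙 c.X)) ≫ (leftUnit c.X).hom = 𝟙 c.X :=
    (Iso.comp_hom_eq_id _).2 (ComonObj.counit_comul c.X)
  have h₂ := congrArg (fun φ => evalMapApp φ A) h₁
  simp only [evalMapApp_comp, evalMapApp_triMap_eq, evalMapApp_id, evalMapApp_leftUnit_hom,
    Category.assoc, Category.id_comp, Functor.map_id, evalCompHom_inv_assoc] at h₂
  change (evalMapApp δ A ≫ c.X.evalCompInv c.X A) ≫ evalMapApp ε (c.X.eval.obj A) ≫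
    evalUnit.hom.app (c.X.eval.obj A) = _
  simpa only [Category.assoc] using h₂

theorem comonad_right_counit (c : Comon (PolyIn E)) (A : E) :
    (comonadComul c).app A ≫ c.X.eval.map ((comonadCounit c).app A) = 𝟙 (c.X.eval.obj A) := by
  let δ : c.X ⟶ c.X.tri c.X := ComonObj.comul
  let ε : c.X ⟶ unit E := ComonObj.counit
  have h₁ : (δ ≫ triMap (𝟙 c.X) ε) ≫ (rightUnit c.X).hom = 𝟙 c.X :=
    (Iso.comp_hom_eq_id _).2 (ComonObj.comul_counit c.X)
  have h₂ := congrArg (fun φ => evalMapApp φ A) h₁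
  simp only [evalMapApp_comp, evalMapApp_triMap_eq, evalMapApp_id, evalMapApp_rightUnit_hom,
    Category.assoc, Category.id_comp, evalCompHom_inv_assoc] at h₂
  change (evalMapApp δ A ≫ c.X.evalCompInv c.X A) ≫ c.X.eval.map (evalMapApp ε A ≫
    evalUnit.hom.app A) = _
  simpa only [Category.assoc, Functor.map_comp] using h₂

/-- The comonad on `E` of a comonoid in polynomials. -/
def comonad (c : Comon (PolyIn E)) : Comonad E where
  toFunctor := c.X.eval
  ε := comonadCounit c
  δ := comonadComul c
  coassoc := comonad_coassoc c
  left_counit := comonad_left_counit c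
  right_counit := comonad_right_counit c

/-- The category of coalgebras of a comonoid `c` in polynomials: objects `S` with a coaction
`S ⟶ c.X.eval.obj S` that is counital and coassociative. -/
abbrev Coalg (c : Comon (PolyIn E)) : Type (max u v) := (comonad c).Coalgebra

variable {c d : Comon (PolyIn E)} (m : Bicomodule c d)

/-- The natural transformation `P(m) ⟶ P(c) ∘ P(m)` induced by the left coaction. -/
def evalLeft : m.X.eval ⟶ m.X.eval ⋙ c.X.eval :=
  evalMap m.left ≫ (evalComp c.X m.X).inv

/-- The natural transformation `P(m) ⟶ P(m) ∘ P(d)` induced by the right coaction. -/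
def evalRight : m.X.eval ⟶ d.X.eval ⋙ m.X.eval :=
  evalMap m.right ≫ (evalComp m.X d.X).inv

end PolyIn
end CategoryTheory

end

/-! The argument takes place at the level of functors. Evaluation turns the composition product into
composition, so `c` and `d` become comonads `C` and `D` on `E`, and the bicomodule becomes a functor
`N = P(m)` with commuting coactions `N ⟶ C N` and `N ⟶ N D` (`evalBicoaction`). For a `D`-coalgebra
`S`, the object `F(S)` is the equalizer of `N S ⇉ N D S`, so the first claim holds by construction.
If `C` preserves equalizers, then `C(F(S))` is the equalizer of `C N S ⇉ C N D S`. Since the two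
coactions commute, the restriction of the left coaction to `F(S)` equalizes this pair and hence
factors through `C(F(S))` (`exists_coaction`). This gives the second claim.

Preservation of connected limits rests on familial representability. Maps `T ⟶ P(p)(S)` over a fixed
`a : T ⟶ P` correspond to maps `T ×_P p_* ⟶ S`. So for each `T` the functor `S ↦ Hom(T, P(p)(S))` is
a disjoint union, over all `a`, of representable functors. Representables preserve limits and
disjoint unions of sets commute with connected limits, so every functor with this property preserves
connected limits (`IsFamilial.preservesLimitsOfShape`). In particular `C` preserves equalizers.

The decisive point is that the property passes from `N` to the functor sending `S` to the underlying
object of `F(S)` (`isFamilial_carrierFunctor`). The object `W` that represents `N` over `a` has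
exactly one `D`-coaction for which the universal element lies in the equalizer, and with it `W`
represents the new functor. No limit of `D`-coalgebras has to be computed for this. Finally, as `C`
preserves connected limits, a cone of `C`-coalgebras over a connected diagram is a limit cone as
soon as its underlying cone in `E` is one. -/

noncomputable section

namespace CategoryTheory

/-! ### Familial functors and connected limits -/

section Familial

variable {A : Type*} [Category* A] {E : Type*} [Category* E]

theorem map_comp_toConst {N : A ⥤ E} {B : E} (π : N ⟶ (Functor.const A).obj B) {S S' : A}
    (f : S ⟶ S') : N.map f ≫ π.app S' = π.app S :=
  (π.naturality f).trans (Category.comp_id _)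

/-- A functor `N` over a constant functor is familial if, for every `a : T ⟶ B`, the elements of
`N.obj S` over `a` at stage `T` are represented by an object of the source category. -/
def IsFamilial (N : A ⥤ E) {B : E} (π : N ⟶ (Functor.const A).obj B) : Prop :=
  ∀ ⦃T : E⦄ (a : T ⟶ B), ∃ (W : A) (η : T ⟶ N.obj W), η ≫ π.app W = a ∧
    ∀ ⦃S : A⦄ (z : T ⟶ N.obj S), z ≫ π.app S = a → ∃! g : W ⟶ S, η ≫ N.map g = z

/-- At each stage `T`, the elements of `N` form a disjoint union of representable functors indexed
by the maps `T ⟶ B`. A cone with vertex `T` over a connected diagram stays inside one summand, where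
it amounts to a cone in `A` with vertex `W`. -/
theorem IsFamilial.preservesLimitsOfShape {N : A ⥤ E} {B : E}
    {π : N ⟶ (Functor.const A).obj B} (h : IsFamilial N π) (J : Type*) [Category* J]
    [IsConnected J] : PreservesLimitsOfShape J N where
  preservesLimit {K} := ⟨fun {c} hc => by
    have key : ∀ s : Cone (K ⋙ N), ∃! l : s.pt ⟶ N.obj c.pt,
        ∀ j, l ≫ N.map (c.π.app j) = s.π.app j := by
      intro s
      let j₀ : J := Classical.arbitrary J
      -- Each arrow of `J` leaves the composite to `B` unchanged, so by connectedness all legs lie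
      -- over the same map and share one representing object `W`.
      have hconst (j : J) : s.π.app j ≫ π.app (K.obj j) = s.π.app j₀ ≫ π.app (K.obj j₀) := by
        refine constant_of_preserves_morphisms
          (fun j => (s.π.app j ≫ π.app (K.obj j) : s.pt ⟶ B)) (fun i j f => ?_) j j₀
        have := s.w f
        dsimp at this ⊢
        rw [← this, Category.assoc, map_comp_toConst]
      obtain ⟨W, η, hη, hu⟩ := h (s.π.app j₀ ≫ π.app (K.obj j₀))
      choose g hg hg' using fun j => hu (s.π.app j) (hconst j)
      -- The maps `g j` form a cone because, for `f : i ⟶ j`, both `g i ≫ K.map f` and `g j` factor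
      -- the leg at `j` through `η`.
      let t : Cone K :=
        { pt := W
          π := { app := g
                 naturality := fun i j f => by
                  refine (Category.id_comp _).trans (hg' j _ ?_).symm
                  have := s.w f
                  dsimp at this ⊢
                  rw [N.map_comp, ← Category.assoc, hg, this] } }
      refine ⟨η ≫ N.map (hc.lift t), fun j => ?_, fun l hl => ?_⟩
      · rw [Category.assoc, ← N.map_comp, hc.fac]
        exact hg j
      -- A competing lift lies over the same map to `B`, so it is `η ≫ N.map k` for some `k`. The
      -- composites of `k` with the legs are forced to be the `g j`, which identifies `k` with the
      -- lift of `t`.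
      · have hl₀ : l ≫ π.app c.pt = s.π.app j₀ ≫ π.app (K.obj j₀) := by
          rw [← hl j₀, Category.assoc, map_comp_toConst]
        obtain ⟨k, hk, -⟩ := hu l hl₀
        obtain rfl : k = hc.lift t := hc.hom_ext fun j => by
          rw [hc.fac]
          refine hg' j _ ?_
          dsimp only
          rw [N.map_comp, ← Category.assoc, hk, hl]
        exact hk.symm
    choose l hl hl' using key
    exact ⟨{ lift := l, fac := hl, uniq := hl' }⟩⟩

end Familial

/-! ### Functors with commuting coactions of two comonads -/

namespace Comonad

variable {E : Type*} [Category* E] (C D : Comonad E) (N : E ⥤ E)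

/-- A functor `N` with commuting coactions of a comonad `C` after it and of a comonad `D`
before it. -/
structure Bicoaction where
  left : N ⟶ N ⋙ C.toFunctor
  right : N ⟶ D.toFunctor ⋙ N
  left_counit (S : E) : left.app S ≫ C.ε.app (N.obj S) = 𝟙 _
  left_coassoc (S : E) : left.app S ≫ C.map (left.app S) = left.app S ≫ C.δ.app (N.obj S)
  right_counit (S : E) : right.app S ≫ N.map (D.ε.app S) = 𝟙 _
  right_coassoc (S : E) : right.app S ≫ N.map (D.δ.app S) = right.app S ≫ right.app (D.obj S)
  compat (S : E) : left.app S ≫ C.map (right.app S) = right.app S ≫ left.app (D.obj S)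

namespace Bicoaction

variable {C D N} (m : Bicoaction C D N)

theorem left_naturality {S S' : E} (f : S ⟶ S') :
    N.map f ≫ m.left.app S' = m.left.app S ≫ C.map (N.map f) :=
  m.left.naturality f

theorem right_naturality {S S' : E} (f : S ⟶ S') :
    N.map f ≫ m.right.app S' = m.right.app S ≫ N.map (D.map f) :=
  m.right.naturality f

/-- Counitality forces this: `N.map (D.ε.app S)` is a map over `B` and a retraction of the coaction.
It is what makes the universal property of a familial `N` applicable to the coacted universal
element. -/
theorem right_over {B : E} (π : N ⟶ (Functor.const E).obj B) (S : E) :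
    m.right.app S ≫ π.app (D.obj S) = π.app S := by
  calc _ = m.right.app S ≫ N.map (D.ε.app S) ≫ π.app S :=
        congrArg _ (map_comp_toConst π (D.ε.app S)).symm
    _ = _ := by rw [← Category.assoc, m.right_counit, Category.id_comp]

/-! ### The equalizer functor on coalgebras -/

variable [HasEqualizers E]

/-- The underlying object of the coalgebra obtained from a `D`-coalgebra. -/
def carrier (S : D.Coalgebra) : E := equalizer (m.right.app S.A) (N.map S.a)

/-- The inclusion of the carrier. -/
def incl (S : D.Coalgebra) : m.carrier S ⟶ N.obj S.A :=
  equalizer.ι (m.right.app S.A) (N.map S.a)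

instance (S : D.Coalgebra) : Mono (m.incl S) := inferInstanceAs (Mono (equalizer.ι _ _))

theorem incl_condition (S : D.Coalgebra) :
    m.incl S ≫ m.right.app S.A = m.incl S ≫ N.map S.a :=
  equalizer.condition _ _

/-- The inclusion of the carrier is an equalizer. -/
def isLimitIncl (S : D.Coalgebra) : IsLimit (Fork.ofι (m.incl S) (m.incl_condition S)) :=
  equalizerIsEqualizer _ _

/-- The universal property of the carrier. -/
def carrierLift (S : D.Coalgebra) {T : E} (z : T ⟶ N.obj S.A)
    (w : z ≫ m.right.app S.A = z ≫ N.map S.a) : T ⟶ m.carrier S :=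
  equalizer.lift z w

@[simp]
theorem carrierLift_incl (S : D.Coalgebra) {T : E} (z : T ⟶ N.obj S.A)
    (w : z ≫ m.right.app S.A = z ≫ N.map S.a) : m.carrierLift S z w ≫ m.incl S = z :=
  equalizer.lift_ι _ _

theorem map_condition {S S' : D.Coalgebra} (f : S ⟶ S') :
    (m.incl S ≫ N.map f.f) ≫ m.right.app S'.A = (m.incl S ≫ N.map f.f) ≫ N.map S'.a := by
  rw [Category.assoc, right_naturality, ← Category.assoc, incl_condition, Category.assoc,
    Category.assoc, ← N.map_comp, ← N.map_comp, f.h]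

/-- The map between carriers induced by a morphism of coalgebras. -/
def carrierMap {S S' : D.Coalgebra} (f : S ⟶ S') : m.carrier S ⟶ m.carrier S' :=
  m.carrierLift S' (m.incl S ≫ N.map f.f) (m.map_condition f)

theorem carrierMap_incl {S S' : D.Coalgebra} (f : S ⟶ S') :
    m.carrierMap f ≫ m.incl S' = m.incl S ≫ N.map f.f :=
  m.carrierLift_incl _ _ _

theorem carrierMap_incl_assoc {S S' : D.Coalgebra} (f : S ⟶ S') {Z : E} (k : N.obj S'.A ⟶ Z) :
    m.carrierMap f ≫ m.incl S' ≫ k = m.incl S ≫ N.map f.f ≫ k := by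
  rw [← Category.assoc, carrierMap_incl, Category.assoc]

/-- The functor which sends a `D`-coalgebra to its carrier. -/
def carrierFunctor : D.Coalgebra ⥤ E where
  obj := m.carrier
  map := m.carrierMap
  map_id S := by simp [carrierMap_incl, ← cancel_mono (m.incl S)]
  map_comp {S S' S''} f g := by
    simp [carrierMap_incl, carrierMap_incl_assoc, ← cancel_mono (m.incl S'')]

/-- The object `W` representing `N` over `a` acquires a `D`-coaction from the right coaction. An
element of `N.obj S.A` over `a` is a map `W ⟶ S.A`, and it lies in the equalizer exactly when that
map is a coalgebra morphism. -/
theorem isFamilial_carrierFunctor {B : E} (π : N ⟶ (Functor.const E).obj B)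
    (hN : IsFamilial N π) : ∃ π' : m.carrierFunctor ⟶ (Functor.const D.Coalgebra).obj B,
      IsFamilial m.carrierFunctor π' := by
  let π' : m.carrierFunctor ⟶ (Functor.const D.Coalgebra).obj B :=
    { app := fun S => m.incl S ≫ π.app S.A
      naturality := fun S S' f => by
        refine Eq.trans ?_ (Category.comp_id (m.incl S ≫ π.app S.A)).symm
        change m.carrierMap f ≫ m.incl S' ≫ π.app S'.A = _
        rw [carrierMap_incl_assoc, map_comp_toConst] }
  refine ⟨π', fun T a => ?_⟩
  obtain ⟨W, η, hη, hu⟩ := hN a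
  -- A map out of `W` is determined by its effect on the universal element `η`; the coalgebra laws
  -- below are checked there.
  have ext {X : E} {g g' : W ⟶ X} (h : η ≫ N.map g = η ≫ N.map g') : g = g' :=
    (hu (η ≫ N.map g') (by rw [Category.assoc, map_comp_toConst, hη])).unique h rfl
  -- The coacted element still lies over `a`, so it is classified by a map `σ`, the only coaction on
  -- `W` that puts `η` into the carrier.
  obtain ⟨σ, hσ, -⟩ := hu (η ≫ m.right.app W) (by
    rw [Category.assoc, ← hη]
    exact congrArg _ (m.right_over π W))
  -- The right coaction sends the element classified by `g` to the one classified by `σ ≫ D.map g`,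
  -- whereas `N.map S.a` would send it to the one classified by `g ≫ S.a`. Equality of the two is
  -- the equation for a coalgebra morphism.
  have hcoalg {X : E} (g : W ⟶ X) :
      (η ≫ N.map g) ≫ m.right.app X = η ≫ N.map (σ ≫ D.map g) := by
    rw [Category.assoc, right_naturality, ← Category.assoc, ← hσ, Category.assoc, ← N.map_comp]
  -- The laws for `σ` are the counit and coassociativity laws of the right coaction, read off at
  -- `η`.
  let W' : D.Coalgebra :=
    { A := W
      a := σ
      counit := ext (by
        rw [N.map_comp, ← Category.assoc, hσ, Category.assoc, m.right_counit, N.map_id])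
      coassoc := ext (by
        rw [← hcoalg, N.map_comp, ← Category.assoc, hσ, Category.assoc, m.right_coassoc,
          Category.assoc]) }
  refine ⟨W', m.carrierLift W' η hσ.symm, ?_, fun S z hz => ?_⟩
  · calc _ = (m.carrierLift W' η hσ.symm ≫ m.incl W') ≫ π.app W := (Category.assoc _ _ _).symm
      _ = a := by rw [carrierLift_incl, hη]
  · change T ⟶ m.carrier S at z
    have hmap (g : W' ⟶ S) :
        (m.carrierLift W' η hσ.symm ≫ m.carrierMap g) ≫ m.incl S = η ≫ N.map g.f := by
      rw [Category.assoc, carrierMap_incl, ← Category.assoc, carrierLift_incl]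
    obtain ⟨g, hg, hg'⟩ := hu (z ≫ m.incl S) ((Category.assoc _ _ _).trans hz)
    -- The map `g` classifying `z ≫ m.incl S` respects the coactions because `z` takes values in the
    -- equalizer.
    refine ⟨⟨g, ext ?_⟩, ?_, fun k hk => ?_⟩
    · change η ≫ N.map (σ ≫ D.map g) = _
      rw [← hcoalg, hg, Category.assoc, incl_condition, ← Category.assoc, ← hg, Category.assoc,
        ← N.map_comp]
    · exact (cancel_mono (m.incl S)).1 ((hmap _).trans hg)
    · exact Coalgebra.Hom.ext (hg' k.f ((hmap k).symm.trans (congrArg (fun l => l ≫ m.incl S) hk)))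

/-! ### The induced coaction on the equalizer -/

variable [PreservesLimitsOfShape WalkingParallelPair C.toFunctor]

/-- As `C` preserves equalizers, its image of the inclusion is again an equalizer. Cancelling this
map reduces statements about the new coaction to statements about the left coaction of `N`. -/
instance (S : D.Coalgebra) : Mono (C.map (m.incl S)) :=
  mono_of_isLimit_fork (isLimitForkMapOfIsLimit C.toFunctor _ (m.isLimitIncl S))

/-- The same with `C` applied twice, as needed to test coassociativity. -/
instance (S : D.Coalgebra) : Mono (C.map (C.map (m.incl S))) :=
  mono_of_isLimit_fork (isLimitForkMapOfIsLimit C.toFunctor _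
    (isLimitForkMapOfIsLimit C.toFunctor _ (m.isLimitIncl S)))

/-- The target is the equalizer of the `C`-images of the two maps defining the carrier. Commutation
of the coactions, the equalizer condition and naturality of the left coaction show, in this order,
that the restricted left coaction equalizes them. -/
theorem exists_coaction (S : D.Coalgebra) :
    ∃ s : m.carrier S ⟶ C.obj (m.carrier S),
      s ≫ C.map (m.incl S) = m.incl S ≫ m.left.app S.A := by
  have h := isLimitForkMapOfIsLimit C.toFunctor _ (m.isLimitIncl S)
  refine ⟨Fork.IsLimit.lift h (m.incl S ≫ m.left.app S.A) ?_, Fork.IsLimit.lift_ι h⟩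
  rw [Category.assoc, m.compat, ← Category.assoc, incl_condition, Category.assoc,
    left_naturality, Category.assoc]

/-- The coaction on the carrier. -/
def coaction (S : D.Coalgebra) : m.carrier S ⟶ C.obj (m.carrier S) :=
  (m.exists_coaction S).choose

theorem coaction_incl (S : D.Coalgebra) :
    m.coaction S ≫ C.map (m.incl S) = m.incl S ≫ m.left.app S.A :=
  (m.exists_coaction S).choose_spec

theorem coaction_incl_assoc (S : D.Coalgebra) {Z : E} (k : C.obj (N.obj S.A) ⟶ Z) :
    m.coaction S ≫ C.map (m.incl S) ≫ k = m.incl S ≫ m.left.app S.A ≫ k := by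
  rw [← Category.assoc, coaction_incl, Category.assoc]

theorem coaction_carrierMap {S S' : D.Coalgebra} (f : S ⟶ S') :
    m.coaction S ≫ C.map (m.carrierMap f) = m.carrierMap f ≫ m.coaction S' := by
  rw [← cancel_mono (C.map (m.incl S')), Category.assoc, Category.assoc, coaction_incl,
    ← C.map_comp, carrierMap_incl, C.map_comp, coaction_incl_assoc, carrierMap_incl_assoc,
    left_naturality]

/-- The `C`-coalgebra obtained from a `D`-coalgebra. -/
def coalgebra (S : D.Coalgebra) : C.Coalgebra where
  A := m.carrier S
  a := m.coaction S
  counit := by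
    have h : C.map (m.incl S) ≫ C.ε.app _ = C.ε.app (m.carrier S) ≫ m.incl S := C.ε.naturality _
    rw [← cancel_mono (m.incl S), Category.assoc, ← h, coaction_incl_assoc,
      m.left_counit, Category.comp_id, Category.id_comp]
  coassoc := by
    have h : C.map (m.incl S) ≫ C.δ.app _ =
        C.δ.app (m.carrier S) ≫ C.map (C.map (m.incl S)) := C.δ.naturality _
    rw [← cancel_mono (C.map (C.map (m.incl S))), Category.assoc, Category.assoc, ← h,
      coaction_incl_assoc, ← C.map_comp, coaction_incl, C.map_comp,
      coaction_incl_assoc, m.left_coassoc]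

/-- The functor from `D`-coalgebras to `C`-coalgebras given by a bicoaction. -/
def coalgebraFunctor : D.Coalgebra ⥤ C.Coalgebra where
  obj := m.coalgebra
  map f :=
    { f := m.carrierMap f
      h := m.coaction_carrierMap f }
  map_id S := Coalgebra.Hom.ext (m.carrierFunctor.map_id S)
  map_comp f g := Coalgebra.Hom.ext (m.carrierFunctor.map_comp f g)

/-- The inclusions of the carriers as a natural transformation. -/
def inclNatTrans : m.coalgebraFunctor ⋙ C.forget ⟶ D.forget ⋙ N where
  app := m.incl
  naturality _ _ f := m.carrierMap_incl f

/-- The forgetful functor from `C`-coalgebras reflects limits of the shapes that `C` preserves, so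
it suffices that the carrier functor preserves them. -/
theorem preservesLimitsOfShape_coalgebraFunctor (J : Type*) [Category* J]
    [PreservesLimitsOfShape J C.toFunctor] [PreservesLimitsOfShape J m.carrierFunctor] :
    PreservesLimitsOfShape J m.coalgebraFunctor where
  preservesLimit {K} := ⟨fun {c} hc => ⟨by
    have hG : IsLimit (m.carrierFunctor.mapCone c) := isLimitOfPreserves _ hc
    have hCG : IsLimit (C.toFunctor.mapCone (m.carrierFunctor.mapCone c)) :=
      isLimitOfPreserves _ hG
    let u (s : Cone (K ⋙ m.coalgebraFunctor)) : Cone (K ⋙ m.carrierFunctor) :=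
      C.forget.mapCone s
    have fac (s j) : hG.lift (u s) ≫ m.carrierFunctor.map (c.π.app j) = (s.π.app j).f :=
      hG.fac (u s) j
    exact
      -- The lift in `E` is compatible with the coactions: maps into the `C`-image of the limit cone
      -- are tested on its legs, and there the claim follows because the legs of both cones are
      -- coalgebra morphisms.
      { lift := fun s => ⟨hG.lift (u s), hCG.hom_ext fun j => by
          have hs : s.pt.a ≫ C.map (s.π.app j).f = (s.π.app j).f ≫ m.coaction (K.obj j) :=
            (s.π.app j).h
          have hm := m.coaction_carrierMap (c.π.app j)
          have hf : hG.lift (u s) ≫ m.carrierMap (c.π.app j) = (s.π.app j).f := fac s j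
          have hf' : C.map (hG.lift (u s)) ≫ C.map (m.carrierMap (c.π.app j)) =
            C.map (s.π.app j).f := (C.map_comp _ _).symm.trans (congrArg _ hf)
          exact (Category.assoc _ _ _).trans ((congrArg _ hf').trans (hs.trans
            ((congrArg (fun k => k ≫ _) hf.symm).trans ((Category.assoc _ _ _).trans
              ((congrArg _ hm.symm).trans (Category.assoc _ _ _).symm)))))⟩
        fac := fun s j => Coalgebra.Hom.ext (fac s j)
        uniq := fun s l hl => Coalgebra.Hom.ext
          (hG.uniq (u s) l.f fun j => congrArg Coalgebra.Hom.f (hl j)) }⟩⟩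

end Bicoaction

end Comonad

/-! ### Polynomial functors are familial -/

namespace PolyIn

variable {E : Type u} [Category.{v} E] [HasFiniteLimits E]

/-- The projection to the positions as a natural transformation. -/
def evalFstNatTrans (p : PolyIn E) : p.eval ⟶ (Functor.const E).obj p.pos where
  app := p.evalFst
  naturality _ _ h := (p.eval_map_fst h).trans (Category.comp_id _).symm

/-- This is the universal property of the polynomial functor: the representing object is `T
×_{p.pos} p.dir`, and the universal element is the one whose evaluation map is the identity. -/
theorem isFamilial_eval (p : PolyIn E) : IsFamilial p.eval p.evalFstNatTrans := by
  intro T a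
  refine ⟨pullback a p.proj, p.evalMk a (𝟙 _), p.evalMk_fst _ _, fun S z hz => ?_⟩
  have hz' : z ≫ p.evalFst S = a := hz
  have hw : (pullback.fst a p.proj ≫ z) ≫ p.evalFst S = pullback.snd a p.proj ≫ p.proj := by
    rw [Category.assoc, hz', pullback.condition]
  -- The element obtained from the universal one along `g` takes the value of `g` at each direction;
  -- existence and uniqueness are both read off from this.
  have val {X : E} (g : pullback a p.proj ⟶ X) {C : E} (b : C ⟶ T) (x : C ⟶ p.dir)
      (w : (b ≫ p.evalMk a (𝟙 _) ≫ p.eval.map g) ≫ p.evalFst X = x ≫ p.proj)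
      (w' : b ≫ a = x ≫ p.proj) :
      p.evalAt (b ≫ p.evalMk a (𝟙 _) ≫ p.eval.map g) x w = pullback.lift b x w' ≫ g := by
    refine (p.evalAt_congr (Category.assoc _ _ _).symm rfl w).trans ?_
    rw [evalAt_comp_eval_map, evalAt_evalMk, Category.comp_id]
  refine ⟨p.evalAt (pullback.fst a p.proj ≫ z) (pullback.snd a p.proj) hw, ?_, fun g hg => ?_⟩
  · refine p.eval_hom_ext (by simp [hz']) fun b x w w' => ?_
    rw [val _ b x w (by rw [← hz', ← Category.assoc]; exact w')]
    exact p.comp_evalAt_eq _ _ _ _ (pullback.lift_fst_assoc _ _ _ _) (pullback.lift_snd _ _ _)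
  -- Evaluation at the generic direction over `a`, given by the two pullback projections, recovers
  -- `g`.
  · dsimp only at hg
    have h := val g (pullback.fst a p.proj) (pullback.snd a p.proj)
      (by simp [pullback.condition]) pullback.condition
    have e : pullback.lift (pullback.fst a p.proj) (pullback.snd a p.proj) pullback.condition =
        𝟙 (pullback a p.proj) := by
      apply pullback.hom_ext <;> simp
    rw [e, Category.id_comp] at h
    exact h.symm.trans (p.evalAt_congr (by rw [hg]) rfl _)

/-! ### From bicomodules to coactions of comonads -/

section Bicoaction

variable {c d : Comon (PolyIn E)} (m : Bicomodule c d) (A : E)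

/-- Each of these five laws is the corresponding bicomodule axiom, evaluated at `A` and transported
along the comparison between composition products and composites of functors. -/
theorem evalLeft_counit :
    (evalLeft m).app A ≫ (comonadCounit c).app (m.X.eval.obj A) = 𝟙 (m.X.eval.obj A) := by
  let κ : m.X ⟶ c.X.tri m.X := m.left
  let ε : c.X ⟶ unit E := ComonObj.counit
  -- The inverse unitor is moved across because the forward unitor has the explicit evaluation
  -- formula.
  have h₁ : (κ ≫ triMap ε (𝟙 m.X)) ≫ (leftUnit m.X).hom = 𝟙 m.X :=
    (Iso.comp_hom_eq_id _).2 m.left_counit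
  have h₂ := congrArg (fun φ => evalMapApp φ A) h₁
  simp only [evalMapApp_comp, evalMapApp_triMap_eq, evalMapApp_id, evalMapApp_leftUnit_hom,
    Category.assoc, Category.id_comp, Functor.map_id, evalCompHom_inv_assoc] at h₂
  change (evalMapApp κ A ≫ c.X.evalCompInv m.X A) ≫ evalMapApp ε (m.X.eval.obj A) ≫
    evalUnit.hom.app (m.X.eval.obj A) = _
  simpa only [Category.assoc] using h₂

theorem evalLeft_coassoc :
    (evalLeft m).app A ≫ c.X.eval.map ((evalLeft m).app A) =
      (evalLeft m).app A ≫ (comonadComul c).app (m.X.eval.obj A) := by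
  let κ : m.X ⟶ c.X.tri m.X := m.left
  let δ : c.X ⟶ c.X.tri c.X := ComonObj.comul
  have h₁ : κ ≫ triMap (𝟙 c.X) κ = κ ≫ triMap δ (𝟙 m.X) ≫ (assoc c.X c.X m.X).hom :=
    m.left_coassoc
  have h₂ := congrArg (fun φ => evalMapApp φ A ≫ c.X.evalCompInv (c.X.tri m.X) A ≫
    c.X.eval.map (c.X.evalCompInv m.X A)) h₁
  simp only [evalMapApp_comp, evalMapApp_triMap_eq, evalMapApp_id, evalMapApp_assoc_hom,
    Category.assoc, Category.id_comp, Functor.map_id, evalCompHom_inv_assoc,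
    map_evalCompHom_inv, Category.comp_id] at h₂
  change (evalMapApp κ A ≫ c.X.evalCompInv m.X A) ≫
    c.X.eval.map (evalMapApp κ A ≫ c.X.evalCompInv m.X A) =
    (evalMapApp κ A ≫ c.X.evalCompInv m.X A) ≫ evalMapApp δ (m.X.eval.obj A) ≫
      c.X.evalCompInv c.X (m.X.eval.obj A)
  simpa only [Category.assoc, Functor.map_comp] using h₂

theorem evalRight_counit :
    (evalRight m).app A ≫ m.X.eval.map ((comonadCounit d).app A) = 𝟙 (m.X.eval.obj A) := by
  let χ : m.X ⟶ m.X.tri d.X := m.right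
  let ε : d.X ⟶ unit E := ComonObj.counit
  have h₁ : (χ ≫ triMap (𝟙 m.X) ε) ≫ (rightUnit m.X).hom = 𝟙 m.X :=
    (Iso.comp_hom_eq_id _).2 m.right_counit
  have h₂ := congrArg (fun φ => evalMapApp φ A) h₁
  simp only [evalMapApp_comp, evalMapApp_triMap_eq, evalMapApp_id, evalMapApp_rightUnit_hom,
    Category.assoc, Category.id_comp, evalCompHom_inv_assoc] at h₂
  change (evalMapApp χ A ≫ m.X.evalCompInv d.X A) ≫ m.X.eval.map (evalMapApp ε A ≫
    evalUnit.hom.app A) = _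
  simpa only [Category.assoc, Functor.map_comp] using h₂

theorem evalRight_coassoc :
    (evalRight m).app A ≫ m.X.eval.map ((comonadComul d).app A) =
      (evalRight m).app A ≫ (evalRight m).app (d.X.eval.obj A) := by
  let χ : m.X ⟶ m.X.tri d.X := m.right
  let δ : d.X ⟶ d.X.tri d.X := ComonObj.comul
  have h₁ : χ ≫ triMap (𝟙 m.X) δ = χ ≫ triMap χ (𝟙 d.X) ≫ (assoc m.X d.X d.X).hom :=
    m.right_coassoc
  have h₂ := congrArg (fun φ => evalMapApp φ A ≫ m.X.evalCompInv (d.X.tri d.X) A ≫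
    m.X.eval.map (d.X.evalCompInv d.X A)) h₁
  simp only [evalMapApp_comp, evalMapApp_triMap_eq, evalMapApp_id, evalMapApp_assoc_hom,
    Category.assoc, Category.id_comp, Functor.map_id, evalCompHom_inv_assoc,
    map_evalCompHom_inv, Category.comp_id] at h₂
  change (evalMapApp χ A ≫ m.X.evalCompInv d.X A) ≫
    m.X.eval.map (evalMapApp δ A ≫ d.X.evalCompInv d.X A) =
    (evalMapApp χ A ≫ m.X.evalCompInv d.X A) ≫ evalMapApp χ (d.X.eval.obj A) ≫
      m.X.evalCompInv d.X (d.X.eval.obj A)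
  simpa only [Category.assoc, Functor.map_comp] using h₂

theorem evalLeft_evalRight :
    (evalLeft m).app A ≫ c.X.eval.map ((evalRight m).app A) =
      (evalRight m).app A ≫ (evalLeft m).app (d.X.eval.obj A) := by
  let κ : m.X ⟶ c.X.tri m.X := m.left
  let χ : m.X ⟶ m.X.tri d.X := m.right
  have h₁ : κ ≫ triMap (𝟙 c.X) χ = χ ≫ triMap κ (𝟙 d.X) ≫ (assoc c.X m.X d.X).hom :=
    m.compat
  have h₂ := congrArg (fun φ => evalMapApp φ A ≫ c.X.evalCompInv (m.X.tri d.X) A ≫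
    c.X.eval.map (m.X.evalCompInv d.X A)) h₁
  simp only [evalMapApp_comp, evalMapApp_triMap_eq, evalMapApp_id, evalMapApp_assoc_hom,
    Category.assoc, Category.id_comp, Functor.map_id, evalCompHom_inv_assoc,
    map_evalCompHom_inv, Category.comp_id] at h₂
  change (evalMapApp κ A ≫ c.X.evalCompInv m.X A) ≫
    c.X.eval.map (evalMapApp χ A ≫ m.X.evalCompInv d.X A) =
    (evalMapApp χ A ≫ m.X.evalCompInv d.X A) ≫ evalMapApp κ (d.X.eval.obj A) ≫
      c.X.evalCompInv m.X (d.X.eval.obj A)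
  simpa only [Category.assoc, Functor.map_comp] using h₂

/-- The bicoaction of the comonads of `c` and `d` on the polynomial functor of a bicomodule. -/
def evalBicoaction : Comonad.Bicoaction (comonad c) (comonad d) m.X.eval where
  left := evalLeft m
  right := evalRight m
  left_counit := evalLeft_counit m
  left_coassoc := evalLeft_coassoc m
  right_counit := evalRight_counit m
  right_coassoc := evalRight_coassoc m
  compat := evalLeft_evalRight m

end Bicoaction

theorem preservesLimitsOfShape_comonad (c : Comon (PolyIn E)) (J : Type*) [Category* J]
    [IsConnected J] : PreservesLimitsOfShape J (comonad c).toFunctor :=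
  (isFamilial_eval c.X).preservesLimitsOfShape J

end PolyIn
end CategoryTheory

end

theorem mainTheorem12 {E : Type u} [Category.{v} E] [HasFiniteLimits E]
    (c d : Comon (PolyIn E)) (m : Bicomodule c d) :
    ∃ (F : PolyIn.Coalg d ⥤ PolyIn.Coalg c)
      (ι : F ⋙ (PolyIn.comonad c).forget ⟶ (PolyIn.comonad d).forget ⋙ m.X.eval),
      (∀ S : PolyIn.Coalg d,
        ∃ w : ι.app S ≫ (PolyIn.evalRight m).app S.A = ι.app S ≫ m.X.eval.map S.a,
          Nonempty (IsLimit (Fork.ofι (ι.app S) w))) ∧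
      (∀ S : PolyIn.Coalg d,
        (F.obj S).a ≫ c.X.eval.map (ι.app S) = ι.app S ≫ (PolyIn.evalLeft m).app S.A) ∧
      ∀ (J : Type w) [Category.{w'} J] [IsConnected J], PreservesLimitsOfShape J F := by
  have hc : ∀ (J : Type w) [Category.{w'} J] [IsConnected J],
      PreservesLimitsOfShape J (PolyIn.comonad c).toFunctor := fun J _ _ =>
    PolyIn.preservesLimitsOfShape_comonad c J
  have := PolyIn.preservesLimitsOfShape_comonad c WalkingParallelPair
  let b := PolyIn.evalBicoaction m
  obtain ⟨π, hπ⟩ := b.isFamilial_carrierFunctor _ (PolyIn.isFamilial_eval m.X)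
  refine ⟨b.coalgebraFunctor, b.inclNatTrans, fun S => ⟨b.incl_condition S, ⟨b.isLimitIncl S⟩⟩,
    fun S => b.coaction_incl S, fun J _ _ => ?_⟩
  have := hc J
  have := hπ.preservesLimitsOfShape J
  exact b.preservesLimitsOfShape_coalgebraFunctor J
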